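/- Let $m\in\mathbb{N}\cup\{0\}$. Let $\eta_-\neq\eta_+$ be parallel lines in $\mathbb{R}^2$, let $0<T\le\infty$, and let $\gamma:[-1,1]\times[0,T)\to\mathbb{R}^2$ be a smooth family (smooth up to $t=0$) of regular immersed curves with unit normal $\nu$ (the unit tangent rotated counterclockwise), curvature $k=\langle\gamma_{ss},\nu\rangle$, and $k_{s^\ell}$ the $\ell$-th arclength derivative of $k$, that solves the $L^2$-gradient flow of $\int k_{s^m}^2\,ds$, $$\frac{\partial\gamma}{\partial t}=\Big[(-1)^{m+1}k_{s^{2m+2}}-\sum_{j=1}^m(-1)^j k\,k_{s^{m+j}}k_{s^{m-j}}-\tfrac12 k\,k_{s^m}^2\Big]\nu ,$$ with generalised Neumann boundary conditions: for every $t\in[0,T)$, $\gamma(\pm1,t)\in\eta_\pm$, the curve meets $\eta_\pm$ orthogonally there, and $k_{s^{2i+1}}(\pm1,t)=0$ for $0\le i\le m$. Let $\gamma_0=\gamma(\cdot,0)$ have length $L_0$, curvature $\kappa$, energy $E_0=\int\kappa_{s^m}^2\,ds$ and winding number $\omega=\frac1{2\pi}\int\kappa\,ds=0$. Proposition 4.4.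 There are $\varepsilon>0$ depending only on $m$, and constants $C_{m,\ell}=C_{m,\ell}(L_0,E_0)$ depending only on $m$, $\ell$, $L_0$ and $E_0$ (not on the lines, on $T$ or otherwise on the solution), such that, if the initial energy is small in the scale-invariant sense $$L_0^{2m+1}\int\kappa_{s^m}^2\,ds\le\varepsilon ,$$ then for all $\ell\in\mathbb{N}\cup\{0\}$ and all $t\in[0,T)$ $$\int k_{s^\ell}^2\,ds\le\max\Big\{\int\kappa_{s^\ell}^2\,ds,\;C_{m,\ell}\Big\},$$ and, for $\ell\le m$, even $\int k_{s^\ell}^2\,ds\le C_{m,\ell}$. -/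

import Mathlib

open scoped ContDiff

noncomputable section

namespace CurveFlow

/-- The Euclidean plane. -/
abbrev Plane : Type := EuclideanSpace ℝ (Fin 2)

/-- The parameter interval `[-1, 1]` of all curves. -/
def paramInterval : Set ℝ := Set.Icc (-1) 1

/-- Counterclockwise rotation of the plane by a right angle. -/
def rot (v : Plane) : Plane := !₂[-(v 1), v 0]

/-- The speed `|c'(x)|` of a curve (one-sided derivatives at `x = ± 1`). -/
def speed (c : ℝ → Plane) (x : ℝ) : ℝ := ‖derivWithin c paramInterval x‖

/-- The arclength derivative `f_s = f' / |c'|` along the curve `c` of a scalar or vector-valued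
function `f` of the parameter. -/
def arcDeriv {E : Type*} [NormedAddCommGroup E] [NormedSpace ℝ E]
    (c : ℝ → Plane) (f : ℝ → E) (x : ℝ) : E :=
  (speed c x)⁻¹ • derivWithin f paramInterval x

/-- The unit tangent `c_s`. -/
def unitTangent (c : ℝ → Plane) : ℝ → Plane := arcDeriv c c

/-- The unit normal, the tangent rotated counterclockwise. -/
def unitNormal (c : ℝ → Plane) (x : ℝ) : Plane := rot (unitTangent c x)

/-- The signed curvature `k = ⟨c_ss, ν⟩`, so that `c_ss = k ν`. -/
def curvature (c : ℝ → Plane) (x : ℝ) : ℝ :=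
  inner ℝ (arcDeriv c (unitTangent c) x) (unitNormal c x)

/-- The iterated arclength derivative `k_{s^ℓ}` of the curvature. -/
def curvatureDeriv (c : ℝ → Plane) (ℓ : ℕ) : ℝ → ℝ := (arcDeriv c)^[ℓ] (curvature c)

/-- The integral `∫_c f ds` with respect to arclength. -/
def arcIntegral (c : ℝ → Plane) (f : ℝ → ℝ) : ℝ := ∫ x in (-1 : ℝ)..1, f x * speed c x

/-- The length of a curve. -/
def length (c : ℝ → Plane) : ℝ := arcIntegral c (fun _ => 1)

/-- The winding number `ω = (2π)⁻¹ ∫ k ds`. -/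
def windingNumber (c : ℝ → Plane) : ℝ := (2 * Real.pi)⁻¹ * arcIntegral c (curvature c)

/-- The quantity `∫ k_{s^ℓ}² ds`; for `ℓ = m` this is the energy of the flow below. -/
def energy (ℓ : ℕ) (c : ℝ → Plane) : ℝ := arcIntegral c (fun x => curvatureDeriv c ℓ x ^ 2)

/-- The normal speed
`F = (-1)^(m+1) k_{s^(2m+2)} - ∑_{j=1}^m (-1)^j k k_{s^(m+j)} k_{s^(m-j)} - ½ k k_{s^m}²`. -/
def normalSpeed (m : ℕ) (c : ℝ → Plane) (x : ℝ) : ℝ :=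
  (-1) ^ (m + 1) * curvatureDeriv c (2 * m + 2) x
    - ∑ j ∈ Finset.Icc 1 m,
        (-1) ^ j * (curvature c x * curvatureDeriv c (m + j) x * curvatureDeriv c (m - j) x)
    - 1 / 2 * (curvature c x * curvatureDeriv c m x ^ 2)

/-- The time interval `[0, T)`, where `T = ∞` is allowed. -/
def timeInterval (T : EReal) : Set ℝ := {t | 0 ≤ t ∧ (t : EReal) < T}

/-- The line `{p | ⟨e, p⟩ = a}` with normal vector `e`. -/
def line (e : Plane) (a : ℝ) : Set Plane := {p | inner ℝ e p = a}

/-- `γ t x`, for `t ∈ [0, T)` and `x ∈ [-1, 1]`, is a smooth solution of the `L²`-gradient flow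
`∂γ/∂t = F ν` of `∫ k_{s^m}² ds`, through regular curves whose ends lie on the
parallel lines `η₋ = {⟨e, p⟩ = a}` and `η₊ = {⟨e, p⟩ = b}`, with the `m + 2` generalised Neumann
boundary conditions: the curve meets the lines orthogonally, and all odd arclength derivatives of
the curvature up to order `2m + 1` vanish at the ends. -/
structure IsSolution (m : ℕ) (e : Plane) (a b : ℝ) (T : EReal) (γ : ℝ → ℝ → Plane) : Prop where
  smooth : ContDiffOn ℝ ∞ (Function.uncurry γ) (timeInterval T ×ˢ paramInterval)
  regular : ∀ t ∈ timeInterval T, ∀ x ∈ paramInterval, derivWithin (γ t) paramInterval x ≠ 0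
  flow : ∀ t ∈ timeInterval T, ∀ x ∈ paramInterval,
    HasDerivWithinAt (fun r => γ r x) (normalSpeed m (γ t) x • unitNormal (γ t) x)
      (timeInterval T) t
  left_mem : ∀ t ∈ timeInterval T, γ t (-1) ∈ line e a
  right_mem : ∀ t ∈ timeInterval T, γ t 1 ∈ line e b
  orthogonal : ∀ t ∈ timeInterval T, ∀ x ∈ ({-1, 1} : Set ℝ),
    inner ℝ (unitTangent (γ t) x) (rot e) = 0
  odd_deriv : ∀ t ∈ timeInterval T, ∀ x ∈ ({-1, 1} : Set ℝ), ∀ i ≤ m,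
    curvatureDeriv (γ t) (2 * i + 1) x = 0

end CurveFlow

end

/-! Write F_m for the normal speed of order m and u_i for k_{s^i}. The evolution equations give
dL/dt = -∫ k F_m ds. Up to the factor -2, F_ℓ is the L²-gradient of ∫ k_{s^ℓ}², so d/dt ∫ k_{s^ℓ}²
ds = -2 ∫ F_m F_ℓ ds for every ℓ (`NeumannJet.jetIntegral_firstVariation`). For ℓ = m the energy
decreases.

All integrations by parts are free of boundary terms. Time derivatives of the boundary conditions
force every odd u_i to vanish at the ends (`IsSolution.curvatureDeriv_odd_eq_zero`), and any
differential polynomial of odd weight then vanishes there as well. The mean of k stays zero because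
the winding number does. Hence every u_i has a zero, which yields Poincaré inequalities, and the
norms ‖u_i‖ are log-convex in i. Put X = ‖u_0‖ and define μ by ‖u_N‖ = X μ^(2N). Then ‖u_i‖ ≤ X
μ^(2i) for i ≤ N and sup |u_i| ≤ 2 X μ^(2i+1) for i < N. Integrals of polynomials of degree d + 2
and even weight w < 2N are therefore bounded by C X^(d+2) μ^(2w+d) (`JetBound.of_mem`).

Two comparisons of powers of X and μ finish the argument. In dL/dt the leading term is -‖u_{m+1}‖²,
and the quartic rest is at most C L^(2m+1) E ‖u_{m+1}‖², so with small initial energy a continuity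
argument keeps L ≤ L_0 (`exists_length_estimate`, `IsSolution.length_le_initial`). Poincaré then
bounds all orders ℓ ≤ m. For ℓ > m the leading part of ∫ F_m F_ℓ is ‖u_{ℓ+m+2}‖² = X² μ^(4(ℓ+m+2)),
and the remaining terms are smaller by factors X²/μ² and X⁴/μ⁴. So either the order-ℓ energy is not
increasing, or μ² is at most a multiple of X², which bounds ‖u_ℓ‖ by L and X, hence by L_0 and E_0
(`exists_energy_estimate`, `IsSolution.energy_le_max`). -/

noncomputable section

namespace CurveFlow

/-! ### Smooth functions of time and parameter -/

variable {E : Type*} [NormedAddCommGroup E] [NormedSpace ℝ E]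

/-- `f t x` is smooth for `t ∈ I` and `x ∈ [-1, 1]`, up to the boundary. -/
def SmoothFamily (I : Set ℝ) (f : ℝ → ℝ → E) : Prop :=
  ContDiffOn ℝ ∞ (Function.uncurry f) (I ×ˢ paramInterval)

/-- The partial derivative in the curve parameter. -/
def dSpace (f : ℝ → ℝ → E) (t x : ℝ) : E := derivWithin (f t) paramInterval x

/-- The partial derivative in time. -/
def dTime (I : Set ℝ) (f : ℝ → ℝ → E) (t x : ℝ) : E := derivWithin (fun r => f r x) I t

/-- A time interval with nonempty interior. -/
structure IsTimeInterval (I : Set ℝ) : Prop where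
  convex : Convex ℝ I
  nonempty : (interior I).Nonempty

lemma convex_paramInterval : Convex ℝ paramInterval := convex_Icc _ _

lemma interior_paramInterval_nonempty : (interior paramInterval).Nonempty := by
  rw [paramInterval, interior_Icc]; exact ⟨0, by norm_num⟩

lemma uniqueDiffOn_paramInterval : UniqueDiffOn ℝ paramInterval :=
  uniqueDiffOn_convex convex_paramInterval interior_paramInterval_nonempty

lemma left_mem_paramInterval : (-1 : ℝ) ∈ paramInterval := by simp [paramInterval]

lemma right_mem_paramInterval : (1 : ℝ) ∈ paramInterval := by simp [paramInterval]

lemma mem_paramInterval_of_mem_ends {x : ℝ} (hx : x ∈ ({-1, 1} : Set ℝ)) : x ∈ paramInterval := by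
  rcases hx with rfl | rfl
  · exact left_mem_paramInterval
  · exact right_mem_paramInterval

namespace IsTimeInterval

variable {I : Set ℝ} (hI : IsTimeInterval I)
include hI

lemma uniqueDiffOn : UniqueDiffOn ℝ I := uniqueDiffOn_convex hI.convex hI.nonempty

lemma uniqueDiffOn_prod : UniqueDiffOn ℝ (I ×ˢ paramInterval) :=
  hI.uniqueDiffOn.prod uniqueDiffOn_paramInterval

lemma subset_closure_interior :
    I ×ˢ paramInterval ⊆ closure (interior (I ×ˢ paramInterval)) := by
  have hc : Convex ℝ (I ×ˢ paramInterval) := hI.convex.prod convex_paramInterval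
  have hn : (interior (I ×ˢ paramInterval)).Nonempty := by
    rw [interior_prod_eq]; exact hI.nonempty.prod interior_paramInterval_nonempty
  rw [hc.closure_interior_eq_closure_of_nonempty_interior hn]
  exact subset_closure

end IsTimeInterval

namespace SmoothFamily

variable {I : Set ℝ} {f : ℝ → ℝ → E} {t x : ℝ}

lemma hasFDerivWithinAt (hf : SmoothFamily I f) (ht : t ∈ I) (hx : x ∈ paramInterval) :
    HasFDerivWithinAt (Function.uncurry f)
      (fderivWithin ℝ (Function.uncurry f) (I ×ˢ paramInterval) (t, x))
      (I ×ˢ paramInterval) (t, x) :=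
  ((hf.differentiableOn (by simp)) (t, x) ⟨ht, hx⟩).hasFDerivWithinAt

lemma hasDerivWithinAt_space_aux (hf : SmoothFamily I f) (ht : t ∈ I) (hx : x ∈ paramInterval) :
    HasDerivWithinAt (f t)
      (fderivWithin ℝ (Function.uncurry f) (I ×ˢ paramInterval) (t, x) (0, 1))
      paramInterval x := by
  have hg : HasDerivWithinAt (fun y : ℝ => ((t, y) : ℝ × ℝ)) (0, 1) paramInterval x :=
    (hasDerivWithinAt_const x paramInterval t).prodMk (hasDerivWithinAt_id x paramInterval)
  exact (hf.hasFDerivWithinAt ht hx).comp_hasDerivWithinAt x hg fun y hy => ⟨ht, hy⟩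

lemma hasDerivWithinAt_time_aux (hf : SmoothFamily I f) (ht : t ∈ I) (hx : x ∈ paramInterval) :
    HasDerivWithinAt (fun r => f r x)
      (fderivWithin ℝ (Function.uncurry f) (I ×ˢ paramInterval) (t, x) (1, 0)) I t := by
  have hg : HasDerivWithinAt (fun y : ℝ => ((y, x) : ℝ × ℝ)) (1, 0) I t :=
    (hasDerivWithinAt_id t I).prodMk (hasDerivWithinAt_const t I x)
  exact (hf.hasFDerivWithinAt ht hx).comp_hasDerivWithinAt (f := fun y : ℝ => ((y, x) : ℝ × ℝ)) t hg fun y hy => ⟨hy, hx⟩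

lemma hasDerivWithinAt_space (hf : SmoothFamily I f) (ht : t ∈ I) (hx : x ∈ paramInterval) :
    HasDerivWithinAt (f t) (dSpace f t x) paramInterval x :=
  (hf.hasDerivWithinAt_space_aux ht hx).differentiableWithinAt.hasDerivWithinAt

lemma hasDerivWithinAt_time (hf : SmoothFamily I f) (ht : t ∈ I) (hx : x ∈ paramInterval) :
    HasDerivWithinAt (fun r => f r x) (dTime I f t x) I t :=
  (hf.hasDerivWithinAt_time_aux ht hx).differentiableWithinAt.hasDerivWithinAt

lemma dSpace_eq (hf : SmoothFamily I f) (ht : t ∈ I) (hx : x ∈ paramInterval) :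
    dSpace f t x =
      fderivWithin ℝ (Function.uncurry f) (I ×ˢ paramInterval) (t, x) (0, 1) :=
  (hf.hasDerivWithinAt_space_aux ht hx).derivWithin (uniqueDiffOn_paramInterval x hx)

lemma dTime_eq (hI : IsTimeInterval I) (hf : SmoothFamily I f) (ht : t ∈ I)
    (hx : x ∈ paramInterval) :
    dTime I f t x =
      fderivWithin ℝ (Function.uncurry f) (I ×ˢ paramInterval) (t, x) (1, 0) :=
  (hf.hasDerivWithinAt_time_aux ht hx).derivWithin (hI.uniqueDiffOn t ht)

lemma congr {g : ℝ → ℝ → E} (hf : SmoothFamily I f)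
    (h : ∀ t ∈ I, ∀ x ∈ paramInterval, g t x = f t x) : SmoothFamily I g :=
  ContDiffOn.congr hf fun p hp => h p.1 hp.1 p.2 hp.2

lemma contDiffOn_fderivWithin (hI : IsTimeInterval I) (hf : SmoothFamily I f) :
    ContDiffOn ℝ ∞ (fderivWithin ℝ (Function.uncurry f) (I ×ˢ paramInterval))
      (I ×ˢ paramInterval) :=
  ContDiffOn.fderivWithin hf hI.uniqueDiffOn_prod (by simp)

lemma dSpace (hI : IsTimeInterval I) (hf : SmoothFamily I f) :
    SmoothFamily I (dSpace f) := by
  have h : SmoothFamily I fun t x =>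
      fderivWithin ℝ (Function.uncurry f) (I ×ˢ paramInterval) (t, x) (0, 1) :=
    (hf.contDiffOn_fderivWithin hI).clm_apply contDiffOn_const
  exact h.congr fun t ht x hx => hf.dSpace_eq ht hx

lemma dTime (hI : IsTimeInterval I) (hf : SmoothFamily I f) :
    SmoothFamily I (dTime I f) := by
  have h : SmoothFamily I fun t x =>
      fderivWithin ℝ (Function.uncurry f) (I ×ˢ paramInterval) (t, x) (1, 0) :=
    (hf.contDiffOn_fderivWithin hI).clm_apply contDiffOn_const
  exact h.congr fun t ht x hx => hf.dTime_eq hI ht hx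

/-- Partial derivatives commute. -/
lemma dSpace_dTime_comm (hI : IsTimeInterval I) (hf : SmoothFamily I f) (ht : t ∈ I)
    (hx : x ∈ paramInterval) :
    CurveFlow.dSpace (CurveFlow.dTime I f) t x = CurveFlow.dTime I (CurveFlow.dSpace f) t x := by
  set S := I ×ˢ paramInterval with hS
  set G := fderivWithin ℝ (Function.uncurry f) S with hG
  have hG' : HasFDerivWithinAt G (fderivWithin ℝ G S (t, x)) S (t, x) :=
    (((hf.contDiffOn_fderivWithin hI).differentiableOn (by simp)) (t, x)
      ⟨ht, hx⟩).hasFDerivWithinAt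
  -- Symmetry of the second derivative persists at boundary points, in particular at t = 0 and x =
  -- ±1, since they are limits of interior points.
  have hsymm : IsSymmSndFDerivWithinAt ℝ (Function.uncurry f) S (t, x) :=
    ContDiffWithinAt.isSymmSndFDerivWithinAt (n := ∞) (hf (t, x) ⟨ht, hx⟩)
      (by rw [minSmoothness_of_isRCLikeNormedField]; exact ENat.LEInfty.out)
      hI.uniqueDiffOn_prod (hI.subset_closure_interior ⟨ht, hx⟩) ⟨ht, hx⟩
  have h1 : HasDerivWithinAt (fun y : ℝ => G (t, y) (1, 0))
      (fderivWithin ℝ G S (t, x) (0, 1) (1, 0)) paramInterval x := by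
    have hg : HasDerivWithinAt (fun y : ℝ => ((t, y) : ℝ × ℝ)) (0, 1) paramInterval x :=
      (hasDerivWithinAt_const x paramInterval t).prodMk (hasDerivWithinAt_id x paramInterval)
    have := hG'.comp_hasDerivWithinAt x hg fun y hy => ⟨ht, hy⟩
    simpa using this.clm_apply (hasDerivWithinAt_const x paramInterval ((1 : ℝ), (0 : ℝ)))
  have h2 : HasDerivWithinAt (fun r : ℝ => G (r, x) (0, 1))
      (fderivWithin ℝ G S (t, x) (1, 0) (0, 1)) I t := by
    have hg : HasDerivWithinAt (fun y : ℝ => ((y, x) : ℝ × ℝ)) (1, 0) I t :=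
      (hasDerivWithinAt_id t I).prodMk (hasDerivWithinAt_const t I x)
    have := hG'.comp_hasDerivWithinAt (f := fun y : ℝ => ((y, x) : ℝ × ℝ)) t hg fun y hy => ⟨hy, hx⟩
    simpa using this.clm_apply (hasDerivWithinAt_const t I ((0 : ℝ), (1 : ℝ)))
  have e1 : CurveFlow.dSpace (CurveFlow.dTime I f) t x =
      fderivWithin ℝ G S (t, x) (0, 1) (1, 0) :=
    (h1.congr (fun y hy => hf.dTime_eq hI ht hy) (hf.dTime_eq hI ht hx)).derivWithin
      (uniqueDiffOn_paramInterval x hx)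
  have e2 : CurveFlow.dTime I (CurveFlow.dSpace f) t x =
      fderivWithin ℝ G S (t, x) (1, 0) (0, 1) :=
    (h2.congr (fun y hy => hf.dSpace_eq hy hx) (hf.dSpace_eq ht hx)).derivWithin
      (hI.uniqueDiffOn t ht)
  rw [e1, e2]
  exact hsymm.eq _ _

lemma continuousOn_prod (hf : SmoothFamily I f) :
    ContinuousOn (Function.uncurry f) (I ×ˢ paramInterval) := ContDiffOn.continuousOn hf

lemma continuousOn_space (hf : SmoothFamily I f) (ht : t ∈ I) :
    ContinuousOn (f t) paramInterval :=
  fun _ hx => (hf.hasDerivWithinAt_space ht hx).continuousWithinAt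

lemma add {g : ℝ → ℝ → E} (hf : SmoothFamily I f) (hg : SmoothFamily I g) :
    SmoothFamily I fun t x => f t x + g t x := ContDiffOn.add hf hg

lemma const (a : E) : SmoothFamily I fun _ _ => a := contDiffOn_const

lemma smul {h : ℝ → ℝ → ℝ} (hh : SmoothFamily I h) (hf : SmoothFamily I f) :
    SmoothFamily I fun t x => h t x • f t x := ContDiffOn.smul hh hf

lemma mul {g h : ℝ → ℝ → ℝ} (hg : SmoothFamily I g) (hh : SmoothFamily I h) :
    SmoothFamily I fun t x => g t x * h t x := ContDiffOn.mul hg hh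

lemma pow {g : ℝ → ℝ → ℝ} (hg : SmoothFamily I g) (n : ℕ) :
    SmoothFamily I fun t x => g t x ^ n := ContDiffOn.pow hg n

lemma inv {h : ℝ → ℝ → ℝ} (hh : SmoothFamily I h)
    (h0 : ∀ t ∈ I, ∀ x ∈ paramInterval, h t x ≠ 0) : SmoothFamily I fun t x => (h t x)⁻¹ :=
  ContDiffOn.inv hh fun p hp => h0 p.1 hp.1 p.2 hp.2

end SmoothFamily

/-! ### Parameter integrals -/

section Integral

variable {I : Set ℝ} {f : ℝ → ℝ → ℝ}

lemma uIcc_eq_paramInterval : Set.uIcc (-1 : ℝ) 1 = paramInterval := by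
  rw [Set.uIcc_of_le (by norm_num), paramInterval]

lemma uIoc_subset_paramInterval : Set.uIoc (-1 : ℝ) 1 ⊆ paramInterval :=
  uIcc_eq_paramInterval ▸ Set.uIoc_subset_uIcc

lemma intervalIntegrable_of_continuousOn_paramInterval {g : ℝ → ℝ}
    (hg : ContinuousOn g paramInterval) :
    IntervalIntegrable g MeasureTheory.volume (-1) 1 :=
  ContinuousOn.intervalIntegrable (uIcc_eq_paramInterval ▸ hg)

lemma aestronglyMeasurable_of_continuousOn_paramInterval {g : ℝ → ℝ}
    (hg : ContinuousOn g paramInterval) :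
    MeasureTheory.AEStronglyMeasurable g
      (MeasureTheory.volume.restrict (Set.uIoc (-1 : ℝ) 1)) :=
  (intervalIntegrable_iff.1 (intervalIntegrable_of_continuousOn_paramInterval hg)).aestronglyMeasurable

lemma exists_bound_of_continuousOn {a b : ℝ} (hab : Set.Icc a b ⊆ I)
    (hf : ContinuousOn (Function.uncurry f) (I ×ˢ paramInterval)) :
    ∃ M, ∀ t ∈ Set.Icc a b, ∀ x ∈ paramInterval, ‖f t x‖ ≤ M := by
  have hK : IsCompact (Set.Icc a b ×ˢ paramInterval) := isCompact_Icc.prod isCompact_Icc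
  obtain ⟨M, hM⟩ := hK.exists_bound_of_continuousOn (hf.mono (Set.prod_mono_left hab))
  exact ⟨M, fun t ht x hx => hM (t, x) ⟨ht, hx⟩⟩

lemma continuousOn_slice (hf : ContinuousOn (Function.uncurry f) (I ×ˢ paramInterval)) {t : ℝ}
    (ht : t ∈ I) : ContinuousOn (f t) paramInterval :=
  hf.comp (f := fun x : ℝ => (t, x)) (by fun_prop) fun _ hx => ⟨ht, hx⟩

lemma continuousOn_integral {a b : ℝ}
    (hf : ContinuousOn (Function.uncurry f) (I ×ˢ paramInterval)) (hab : Set.Icc a b ⊆ I) :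
    ContinuousOn (fun t => ∫ x in (-1 : ℝ)..1, f t x) (Set.Icc a b) := by
  obtain ⟨M, hM⟩ := exists_bound_of_continuousOn hab hf
  intro t ht
  refine intervalIntegral.continuousWithinAt_of_dominated_interval (bound := fun _ => M) ?_ ?_
    (by simp) ?_
  · filter_upwards [self_mem_nhdsWithin] with r hr
    exact aestronglyMeasurable_of_continuousOn_paramInterval (continuousOn_slice hf (hab hr))
  · filter_upwards [self_mem_nhdsWithin] with r hr
    exact .of_forall fun x hx => hM r hr x (uIoc_subset_paramInterval hx)
  · refine .of_forall fun x hx => ?_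
    have : ContinuousOn (fun r => f r x) (Set.Icc a b) :=
      hf.comp (f := fun r : ℝ => (r, x)) (by fun_prop)
        fun r hr => ⟨hab hr, uIoc_subset_paramInterval hx⟩
    exact this t ht

lemma SmoothFamily.hasDerivAt_integral (hI : IsTimeInterval I) (hf : SmoothFamily I f) {t : ℝ}
    (ht : t ∈ interior I) :
    HasDerivAt (fun r => ∫ x in (-1 : ℝ)..1, f r x) (∫ x in (-1 : ℝ)..1, CurveFlow.dTime I f t x) t := by
  obtain ⟨δ, hδ, hball⟩ := Metric.isOpen_iff.1 isOpen_interior t ht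
  have hsub : Set.Icc (t - δ / 2) (t + δ / 2) ⊆ interior I := fun r hr => hball (by
    rw [Metric.mem_ball, Real.dist_eq, abs_lt]; constructor <;> linarith [hr.1, hr.2])
  have hnhds : Set.Icc (t - δ / 2) (t + δ / 2) ∈ nhds t :=
    Icc_mem_nhds (by linarith) (by linarith)
  have hsub' := hsub.trans interior_subset
  obtain ⟨M, hM⟩ := exists_bound_of_continuousOn hsub' (hf.dTime hI).continuousOn_prod
  refine (intervalIntegral.hasDerivAt_integral_of_dominated_loc_of_deriv_le
    (bound := fun _ => M) hnhds ?_ ?_ ?_ ?_ (by simp) ?_).2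
  · filter_upwards [hnhds] with r hr
    exact aestronglyMeasurable_of_continuousOn_paramInterval (hf.continuousOn_space (hsub' hr))
  · exact intervalIntegrable_of_continuousOn_paramInterval
      (hf.continuousOn_space (interior_subset ht))
  · exact aestronglyMeasurable_of_continuousOn_paramInterval
      ((hf.dTime hI).continuousOn_space (interior_subset ht))
  · exact .of_forall fun x hx r hr => hM r hr x (uIoc_subset_paramInterval hx)
  · refine .of_forall fun x hx r hr => ?_
    exact (hf.hasDerivWithinAt_time (hsub' hr) (uIoc_subset_paramInterval hx)).hasDerivAt
      (mem_interior_iff_mem_nhds.1 (hsub hr))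

end Integral

end CurveFlow

end

noncomputable section

namespace CurveFlow

/-! ### Weighted integrals on the parameter interval -/

/-- The integral of `f` over `[-1, 1]` with weight `v`. -/
def weightedIntegral (v f : ℝ → ℝ) : ℝ := ∫ x in (-1 : ℝ)..1, f x * v x

/-- The weighted `L²` norm. -/
def weightedNorm (v f : ℝ → ℝ) : ℝ := Real.sqrt (weightedIntegral v fun x => f x ^ 2)

/-- `f` has the arclength derivative `g` with respect to the speed `v`. -/
def HasArcDeriv (v f g : ℝ → ℝ) : Prop :=
  ∀ x ∈ paramInterval, HasDerivWithinAt f (v x * g x) paramInterval x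

/-- A positive continuous weight. -/
structure IsSpeed (v : ℝ → ℝ) : Prop where
  cont : ContinuousOn v paramInterval
  pos : ∀ x ∈ paramInterval, 0 < v x

section Weighted

variable {v f g h f' g' : ℝ → ℝ}

lemma HasArcDeriv.continuousOn (hf : HasArcDeriv v f f') : ContinuousOn f paramInterval :=
  fun x hx => (hf x hx).continuousWithinAt

lemma HasArcDeriv.mul (hf : HasArcDeriv v f f') (hg : HasArcDeriv v g g') :
    HasArcDeriv v (fun x => f x * g x) (fun x => f' x * g x + f x * g' x) := fun x hx =>
  ((hf x hx).mul (hg x hx)).congr_deriv (by ring)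

lemma weightedIntegral_congr (h : ∀ x ∈ paramInterval, f x = g x) :
    weightedIntegral v f = weightedIntegral v g :=
  intervalIntegral.integral_congr fun x hx => by
    simp only [h x (uIcc_eq_paramInterval ▸ hx)]

lemma weightedIntegral_const_mul (a : ℝ) :
    weightedIntegral v (fun x => a * f x) = a * weightedIntegral v f := by
  simp only [weightedIntegral, mul_assoc, intervalIntegral.integral_const_mul]

lemma weightedIntegral_neg :
    weightedIntegral v (fun x => - f x) = - weightedIntegral v f := by
  simp only [weightedIntegral, neg_mul, intervalIntegral.integral_neg]

lemma weightedIntegral_zero : weightedIntegral v (fun _ => 0) = 0 := by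
  simp [weightedIntegral]

variable (hv : IsSpeed v)
include hv

lemma IsSpeed.intervalIntegrable (hf : ContinuousOn f paramInterval) :
    IntervalIntegrable (fun x => f x * v x) MeasureTheory.volume (-1) 1 :=
  intervalIntegrable_of_continuousOn_paramInterval (hf.mul hv.cont)

lemma weightedIntegral_add (hf : ContinuousOn f paramInterval)
    (hg : ContinuousOn g paramInterval) :
    weightedIntegral v (fun x => f x + g x) = weightedIntegral v f + weightedIntegral v g := by
  simp only [weightedIntegral, add_mul]
  exact intervalIntegral.integral_add (hv.intervalIntegrable hf) (hv.intervalIntegrable hg)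

lemma weightedIntegral_mono (hf : ContinuousOn f paramInterval)
    (hg : ContinuousOn g paramInterval) (h : ∀ x ∈ paramInterval, f x ≤ g x) :
    weightedIntegral v f ≤ weightedIntegral v g :=
  intervalIntegral.integral_mono_on (by norm_num) (hv.intervalIntegrable hf)
    (hv.intervalIntegrable hg) fun x hx => mul_le_mul_of_nonneg_right (h x hx) (hv.pos x hx).le

lemma weightedIntegral_nonneg (h : ∀ x ∈ paramInterval, 0 ≤ f x) : 0 ≤ weightedIntegral v f :=
  intervalIntegral.integral_nonneg (by norm_num) fun x hx =>
    mul_nonneg (h x hx) (hv.pos x hx).le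

lemma weightedIntegral_one_pos : 0 < weightedIntegral v (fun _ => 1) := by
  refine intervalIntegral.intervalIntegral_pos_of_pos_on
    (hv.intervalIntegrable continuousOn_const) (fun x hx => ?_) (by norm_num)
  simpa using hv.pos x (Set.Ioo_subset_Icc_self hx)

lemma weightedNorm_sq : weightedNorm v f ^ 2 = weightedIntegral v fun x => f x ^ 2 :=
  Real.sq_sqrt (weightedIntegral_nonneg hv fun _ _ => sq_nonneg _)

omit hv in
lemma weightedNorm_nonneg : 0 ≤ weightedNorm v f := Real.sqrt_nonneg _

/-- Cauchy–Schwarz, from the discriminant of the nonnegative quadratic s ↦ ∫ (s f + g)². -/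
lemma weightedIntegral_mul_sq_le (hf : ContinuousOn f paramInterval)
    (hg : ContinuousOn g paramInterval) :
    weightedIntegral v (fun x => f x * g x) ^ 2 ≤
      weightedIntegral v (fun x => f x ^ 2) * weightedIntegral v (fun x => g x ^ 2) := by
  have key : ∀ s : ℝ, 0 ≤ weightedIntegral v (fun x => f x ^ 2) * (s * s) +
      (2 * weightedIntegral v (fun x => f x * g x)) * s +
      weightedIntegral v (fun x => g x ^ 2) := fun s => by
    have h0 : 0 ≤ weightedIntegral v (fun x => (s * s) * f x ^ 2 + ((2 * s) * (f x * g x) +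
        g x ^ 2)) :=
      weightedIntegral_nonneg hv fun x _ => by nlinarith [sq_nonneg (s * f x + g x)]
    rw [weightedIntegral_add hv (by fun_prop) (by fun_prop),
      weightedIntegral_add hv (by fun_prop) (by fun_prop), weightedIntegral_const_mul,
      weightedIntegral_const_mul] at h0
    linarith
  have := discrim_le_zero key
  rw [discrim] at this
  nlinarith

lemma weightedIntegral_abs_mul_abs_le (hf : ContinuousOn f paramInterval)
    (hg : ContinuousOn g paramInterval) :
    weightedIntegral v (fun x => |f x| * |g x|) ≤ weightedNorm v f * weightedNorm v g := by
  have := weightedIntegral_mul_sq_le hv hf.abs hg.abs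
  simp only [sq_abs] at this
  rw [← weightedNorm_sq hv, ← weightedNorm_sq hv, ← mul_pow] at this
  exact le_of_sq_le_sq this (mul_nonneg weightedNorm_nonneg weightedNorm_nonneg)

lemma abs_weightedIntegral_le (hf : ContinuousOn f paramInterval) :
    |weightedIntegral v f| ≤ weightedIntegral v fun x => |f x| := by
  rw [abs_le]
  constructor
  · rw [← weightedIntegral_neg]
    exact weightedIntegral_mono hv (by fun_prop) hf fun x _ => neg_abs_le _
  · exact weightedIntegral_mono hv hf (by fun_prop) fun x _ => le_abs_self _

lemma HasArcDeriv.integral_eq_sub (hf : HasArcDeriv v f g) (hg : ContinuousOn g paramInterval) :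
    weightedIntegral v g = f 1 - f (-1) := by
  refine intervalIntegral.integral_eq_sub_of_hasDeriv_right
    (uIcc_eq_paramInterval ▸ hf.continuousOn) (fun x hx => ?_) (hv.intervalIntegrable hg)
  have hx' : x ∈ Set.Ioo (-1 : ℝ) 1 := by simpa using hx
  have := (hf x (Set.Ioo_subset_Icc_self hx')).hasDerivAt (Icc_mem_nhds hx'.1 hx'.2)
  rw [mul_comm] at this
  exact this.hasDerivWithinAt

lemma HasArcDeriv.integral_eq_zero (hf : HasArcDeriv v f g) (hg : ContinuousOn g paramInterval)
    (h0 : ∀ x ∈ ({-1, 1} : Set ℝ), f x = 0) : weightedIntegral v g = 0 := by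
  rw [hf.integral_eq_sub hv hg, h0 1 (by simp), h0 (-1) (by simp), sub_zero]

/-- Integration by parts without boundary terms. -/
lemma HasArcDeriv.integral_mul_eq_neg (hf : HasArcDeriv v f f') (hg : HasArcDeriv v g g')
    (hf' : ContinuousOn f' paramInterval) (hg' : ContinuousOn g' paramInterval)
    (h0 : ∀ x ∈ ({-1, 1} : Set ℝ), f x * g x = 0) :
    weightedIntegral v (fun x => f' x * g x) = - weightedIntegral v (fun x => f x * g' x) := by
  have hfc := hf.continuousOn
  have hgc := hg.continuousOn
  have := (hf.mul hg).integral_eq_zero hv (by fun_prop) h0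
  rw [weightedIntegral_add hv (by fun_prop) (by fun_prop)] at this
  linarith

lemma HasArcDeriv.abs_sub_le (hf : HasArcDeriv v f g) (hg : ContinuousOn g paramInterval)
    {x y : ℝ} (hx : x ∈ paramInterval) (hy : y ∈ paramInterval) :
    |f x - f y| ≤ weightedIntegral v fun z => |g z| := by
  wlog hxy : y ≤ x generalizing x y
  · rw [abs_sub_comm]; exact this hy hx (le_of_not_ge hxy)
  have hsub : Set.Icc y x ⊆ paramInterval := Set.Icc_subset_Icc hy.1 hx.2
  have hcont : ContinuousOn (fun z => g z * v z) paramInterval := hg.mul hv.cont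
  have h1 : ∫ z in y..x, g z * v z = f x - f y := by
    refine intervalIntegral.integral_eq_sub_of_hasDeriv_right
      (by rw [Set.uIcc_of_le hxy]; exact hf.continuousOn.mono hsub) (fun z hz => ?_)
      (ContinuousOn.intervalIntegrable (by rw [Set.uIcc_of_le hxy]; exact hcont.mono hsub))
    rw [min_eq_left hxy, max_eq_right hxy] at hz
    have hz' : z ∈ paramInterval := hsub (Set.Ioo_subset_Icc_self hz)
    have := (hf z hz').hasDerivAt (Icc_mem_nhds (hy.1.trans_lt hz.1) (hz.2.trans_le hx.2))
    rw [mul_comm] at this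
    exact this.hasDerivWithinAt
  rw [← h1]
  calc |∫ z in y..x, g z * v z| ≤ ∫ z in y..x, |g z * v z| :=
        intervalIntegral.abs_integral_le_integral_abs hxy
    _ ≤ ∫ z in (-1 : ℝ)..1, |g z * v z| :=
        intervalIntegral.integral_mono_interval hy.1 hxy hx.2
          (.of_forall fun _ => abs_nonneg _)
          (intervalIntegrable_of_continuousOn_paramInterval hcont.abs)
    _ = _ := intervalIntegral.integral_congr fun z hz => by
        simp only [abs_mul, abs_of_pos (hv.pos z (uIcc_eq_paramInterval ▸ hz))]

/-- Integrate (f²)' = 2 f f' from the zero y to x and apply Cauchy–Schwarz. -/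
lemma HasArcDeriv.sq_le_of_zero (hf : HasArcDeriv v f g) (hg : ContinuousOn g paramInterval)
    {x y : ℝ} (hx : x ∈ paramInterval) (hy : y ∈ paramInterval) (h0 : f y = 0) :
    f x ^ 2 ≤ 2 * (weightedNorm v f * weightedNorm v g) := by
  have hfc := hf.continuousOn
  have h1 := (hf.mul hf).abs_sub_le hv (by fun_prop) hx hy
  have h2 : weightedIntegral v (fun z => |g z * f z + f z * g z|) =
      2 * weightedIntegral v (fun z => |f z| * |g z|) := by
    rw [← weightedIntegral_const_mul]
    refine weightedIntegral_congr fun z _ => ?_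
    rw [mul_comm (g z), ← two_mul, abs_mul, abs_mul, abs_two]
  rw [h2, h0, mul_zero, sub_zero, abs_mul_self] at h1
  nlinarith [weightedIntegral_abs_mul_abs_le hv hfc hg]

lemma HasArcDeriv.sq_le_length_mul (hf : HasArcDeriv v f g) (hg : ContinuousOn g paramInterval)
    {x y : ℝ} (hx : x ∈ paramInterval) (hy : y ∈ paramInterval) (h0 : f y = 0) :
    f x ^ 2 ≤ weightedIntegral v (fun _ => 1) * weightedNorm v g ^ 2 := by
  have h1 := hf.abs_sub_le hv hg hx hy
  rw [h0, sub_zero] at h1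
  have h2 := weightedIntegral_mul_sq_le hv continuousOn_const (f := fun _ => 1) hg.abs
  simp only [sq_abs, one_mul, one_pow] at h2
  rw [weightedNorm_sq hv, ← sq_abs]
  exact (pow_le_pow_left₀ (abs_nonneg _) h1 2).trans h2

lemma HasArcDeriv.norm_le_length_mul (hf : HasArcDeriv v f g)
    (hg : ContinuousOn g paramInterval) {y : ℝ} (hy : y ∈ paramInterval) (h0 : f y = 0) :
    weightedNorm v f ≤ weightedIntegral v (fun _ => 1) * weightedNorm v g := by
  have hfc := hf.continuousOn
  have h1 : weightedNorm v f ^ 2 ≤ (weightedIntegral v (fun _ => 1) * weightedNorm v g) ^ 2 := by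
    rw [weightedNorm_sq hv]
    calc weightedIntegral v (fun x => f x ^ 2)
        ≤ weightedIntegral v (fun _ =>
          (weightedIntegral v (fun _ => 1) * weightedNorm v g ^ 2) * 1) :=
          weightedIntegral_mono hv (by fun_prop) continuousOn_const fun x hx => by
            rw [mul_one]; exact hf.sq_le_length_mul hv hg hx hy h0
      _ = _ := by rw [weightedIntegral_const_mul]; ring
  exact le_of_sq_le_sq h1 (mul_nonneg (weightedIntegral_one_pos hv).le weightedNorm_nonneg)

lemma exists_zero_of_weightedIntegral_eq_zero (hf : ContinuousOn f paramInterval)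
    (h0 : weightedIntegral v f = 0) : ∃ y ∈ paramInterval, f y = 0 := by
  by_contra! hne
  have hpc : IsPreconnected paramInterval := isPreconnected_Icc
  -- A zero-free continuous function has constant sign, so its sign at 1 decides the sign of its
  -- integral.
  have key : ∀ g : ℝ → ℝ, ContinuousOn g paramInterval → (∀ x ∈ paramInterval, g x ≠ 0) →
      0 < g 1 → 0 < weightedIntegral v g := fun g hg hgne h1 => by
    refine intervalIntegral.intervalIntegral_pos_of_pos_on
      (hv.intervalIntegrable hg) (fun x hx => ?_) (by norm_num)
    have hx' := Set.Ioo_subset_Icc_self hx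
    refine mul_pos ?_ (hv.pos x hx')
    by_contra! hle
    obtain ⟨y, hy, hy0⟩ := hpc.intermediate_value hx' right_mem_paramInterval hg ⟨hle, h1.le⟩
    exact hgne y hy hy0
  rcases lt_or_gt_of_ne (hne 1 right_mem_paramInterval) with h | h
  · have := key (fun x => - f x) hf.neg (fun x hx => neg_ne_zero.2 (hne x hx)) (by linarith)
    rw [weightedIntegral_neg] at this
    linarith
  · exact (key f hf hne h).ne' h0

end Weighted

/-! ### Jets with Neumann boundary conditions -/

/-- `u 0, u 1, …` are the successive arclength derivatives, with respect to the speed `v`, of a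
function `u 0` of mean zero, the odd ones of which vanish at the ends. -/
structure NeumannJet (v : ℝ → ℝ) (u : ℕ → ℝ → ℝ) : Prop where
  speed : IsSpeed v
  deriv : ∀ i, HasArcDeriv v (u i) (u (i + 1))
  odd : ∀ i, ∀ x ∈ ({-1, 1} : Set ℝ), u (2 * i + 1) x = 0
  mean : weightedIntegral v (u 0) = 0

namespace NeumannJet

variable {v : ℝ → ℝ} {u : ℕ → ℝ → ℝ} (hu : NeumannJet v u)
include hu

lemma cont (i : ℕ) : ContinuousOn (u i) paramInterval := (hu.deriv i).continuousOn

lemma eq_zero_of_odd {i : ℕ} (hi : Odd i) {x : ℝ} (hx : x ∈ ({-1, 1} : Set ℝ)) : u i x = 0 := by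
  obtain ⟨j, rfl⟩ := hi
  exact hu.odd j x hx

/-- Odd orders vanish at the ends. Even orders have mean zero: order 0 by assumption, and a positive
even order is the derivative of an odd one. -/
lemma exists_zero (i : ℕ) : ∃ y ∈ paramInterval, u i y = 0 := by
  rcases Nat.even_or_odd i with h | h
  · refine exists_zero_of_weightedIntegral_eq_zero hu.speed (hu.cont i) ?_
    obtain _ | i := i
    · exact hu.mean
    · exact (hu.deriv i).integral_eq_zero hu.speed (hu.cont _) fun x hx =>
        hu.eq_zero_of_odd (by grind) hx
  · exact ⟨1, right_mem_paramInterval, hu.eq_zero_of_odd h (by simp)⟩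

lemma sq_le (i : ℕ) {x : ℝ} (hx : x ∈ paramInterval) :
    u i x ^ 2 ≤ 2 * (weightedNorm v (u i) * weightedNorm v (u (i + 1))) := by
  obtain ⟨y, hy, h0⟩ := hu.exists_zero i
  exact (hu.deriv i).sq_le_of_zero hu.speed (hu.cont _) hx hy h0

lemma norm_le_succ (i : ℕ) :
    weightedNorm v (u i) ≤ weightedIntegral v (fun _ => 1) * weightedNorm v (u (i + 1)) := by
  obtain ⟨y, hy, h0⟩ := hu.exists_zero i
  exact (hu.deriv i).norm_le_length_mul hu.speed (hu.cont _) hy h0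

lemma norm_le_add (i j : ℕ) :
    weightedNorm v (u i) ≤
      weightedIntegral v (fun _ => 1) ^ j * weightedNorm v (u (i + j)) := by
  induction j with
  | zero => simp
  | succ j ih =>
    refine ih.trans ?_
    rw [pow_succ, mul_assoc, ← add_assoc]
    exact mul_le_mul_of_nonneg_left (hu.norm_le_succ _)
      (pow_nonneg (weightedIntegral_one_pos hu.speed).le _)

/-- Log-convexity of the norms: integrate by parts once and use Cauchy–Schwarz. One of the orders i
and i + 1 is odd, so the boundary term drops. -/
lemma norm_sq_le_mul (i : ℕ) :
    weightedNorm v (u (i + 1)) ^ 2 ≤ weightedNorm v (u i) * weightedNorm v (u (i + 2)) := by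
  have h := (hu.deriv i).integral_mul_eq_neg hu.speed (hu.deriv (i + 1)) (hu.cont _) (hu.cont _)
    fun x hx => by
      rcases Nat.even_or_odd i with h | h
      · rw [hu.eq_zero_of_odd (i := i + 1) (by grind) hx, mul_zero]
      · rw [hu.eq_zero_of_odd h hx, zero_mul]
  have hc := hu.cont i
  have hc2 := hu.cont (i + 1 + 1)
  calc weightedNorm v (u (i + 1)) ^ 2
      = - weightedIntegral v (fun x => u i x * u (i + 1 + 1) x) := by
        rw [weightedNorm_sq hu.speed, ← h]; simp only [sq]
    _ ≤ |weightedIntegral v (fun x => u i x * u (i + 1 + 1) x)| := neg_le_abs _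
    _ ≤ weightedIntegral v (fun x => |u i x * u (i + 1 + 1) x|) :=
        abs_weightedIntegral_le hu.speed (by fun_prop)
    _ ≤ _ := by
        simp only [abs_mul]
        exact weightedIntegral_abs_mul_abs_le hu.speed hc hc2

end NeumannJet

/-! ### Interpolation by log-convexity -/

/-- A log-convex sequence lies below the geometric sequence through two of its points. -/
lemma le_geometric_of_sq_le_mul {a : ℕ → ℝ} {N : ℕ} {lam : ℝ} (ha : ∀ i, 0 ≤ a i)
    (hconv : ∀ i, a (i + 1) ^ 2 ≤ a i * a (i + 2)) (h0 : 0 < a 0) (hlam : 0 < lam)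
    (hN : a N = a 0 * lam ^ N) {i : ℕ} (hi : i ≤ N) : a i ≤ a 0 * lam ^ i := by
  -- The normalised sequence is again log-convex and equals 1 at 0 and N, so a discrete maximum
  -- principle applies.
  set b : ℕ → ℝ := fun i => a i / (a 0 * lam ^ i) with hb
  have hpos : ∀ i, 0 < a 0 * lam ^ i := fun i => by positivity
  have hb0 : b 0 = 1 := by simp [hb, h0.ne']
  have hbN : b N = 1 := by simp only [hb]; rw [hN, div_self (hpos N).ne']
  have hbconv : ∀ i, b (i + 1) ^ 2 ≤ b i * b (i + 2) := fun i => by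
    simp only [hb]
    rw [div_pow, div_mul_div_comm]
    have : (a 0 * lam ^ (i + 1)) ^ 2 = a 0 * lam ^ i * (a 0 * lam ^ (i + 2)) := by ring
    rw [this]
    exact div_le_div_of_nonneg_right (hconv i) (mul_pos (hpos _) (hpos _)).le
  have hbn : ∀ i, 0 ≤ b i := fun i => div_nonneg (ha i) (hpos i).le
  suffices h : b i ≤ 1 by
    simp only [hb] at h
    rwa [div_le_one (hpos i)] at h
  by_contra! hlt
  obtain ⟨j, hj, hjmax⟩ := Finset.exists_max_image (Finset.range (N + 1)) b ⟨i, by simp; omega⟩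
  have hex : ∃ j, j ≤ N ∧ ∀ k ≤ N, b k ≤ b j :=
    ⟨j, by simpa [Nat.lt_succ_iff] using hj, fun k hk => hjmax k (by simp; omega)⟩
  classical
  obtain ⟨hn, hmax⟩ := Nat.find_spec hex
  -- Taking the first maximiser makes its left neighbour strictly smaller, which contradicts
  -- log-convexity at an interior index.
  set n := Nat.find hex with hndef
  have hgt : 1 < b n := hlt.trans_le (hmax i hi)
  have hn0 : n ≠ 0 := fun h => by rw [h, hb0] at hgt; exact lt_irrefl _ hgt
  have hnN : n ≠ N := fun h => by rw [h, hbN] at hgt; exact lt_irrefl _ hgt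
  obtain ⟨p, hp⟩ := Nat.exists_eq_succ_of_ne_zero hn0
  have hpl : b p < b n := by
    by_contra! hle
    exact Nat.find_min hex (m := p) (by omega) ⟨by omega, fun k hk => (hmax k hk).trans hle⟩
  have h1 := hbconv p
  have h2 : b (p + 2) ≤ b n := hmax _ (by omega)
  rw [show p + 1 = n by omega] at h1
  nlinarith [hbn p, hbn (p + 2)]

namespace NeumannJet

variable {v : ℝ → ℝ} {u : ℕ → ℝ → ℝ}

/-- The interpolation inequalities between orders `0` and `N`. -/
lemma exists_interpolation (hu : NeumannJet v u) {N : ℕ} (hN : N ≠ 0) :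
    ∃ μ : ℝ, 0 ≤ μ ∧
      weightedNorm v (u N) = weightedNorm v (u 0) * μ ^ (2 * N) ∧
      (∀ i ≤ N, weightedNorm v (u i) ≤ weightedNorm v (u 0) * μ ^ (2 * i)) ∧
      1 ≤ weightedIntegral v (fun _ => 1) * μ ^ 2 := by
  set X := weightedNorm v (u 0) with hX
  set Y := weightedNorm v (u N) with hY
  set Λ := weightedIntegral v (fun _ => 1) with hΛ
  have hL : 0 < Λ := weightedIntegral_one_pos hu.speed
  have hX0 : 0 ≤ X := weightedNorm_nonneg
  have hY0 : 0 ≤ Y := weightedNorm_nonneg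
  have hXY : X ≤ Λ ^ N * Y := by simpa using hu.norm_le_add 0 N
  rcases hX0.eq_or_lt with hX1 | hXpos
  · have hz : ∀ i, weightedNorm v (u i) = 0 := fun i => by
      induction i with
      | zero => rw [← hX, ← hX1]
      | succ i ih =>
        have h1 := hu.norm_sq_le_mul i
        rw [ih, zero_mul] at h1
        exact pow_eq_zero_iff two_ne_zero |>.1 (le_antisymm h1 (sq_nonneg _))
    -- When u 0 has norm zero so do all u i, and μ is constrained only by the last inequality, which
    -- this choice turns into an equality.
    refine ⟨Real.sqrt Λ⁻¹, Real.sqrt_nonneg _, ?_, fun i _ => ?_, ?_⟩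
    · rw [hY, hz, ← hX1, zero_mul]
    · rw [hz, ← hX1, zero_mul]
    · rw [Real.sq_sqrt (inv_pos.2 hL).le, mul_inv_cancel₀ hL.ne']
  · have hYpos : 0 < Y := by
      rcases hY0.eq_or_lt with h | h
      · rw [← h, mul_zero] at hXY; linarith
      · exact h
    have hq : 0 < Y / X := div_pos hYpos hXpos
    set lam := (Y / X) ^ ((N : ℝ)⁻¹) with hlam
    have hlampos : 0 < lam := Real.rpow_pos_of_pos hq _
    have hlamN : lam ^ N = Y / X := Real.rpow_inv_natCast_pow hq.le hN
    have hs : Real.sqrt lam ^ 2 = lam := Real.sq_sqrt hlampos.le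
    have hNeq : Y = X * lam ^ N := by rw [hlamN]; field_simp
    refine ⟨Real.sqrt lam, Real.sqrt_nonneg _, ?_, fun i hi => ?_, ?_⟩
    · rw [pow_mul, hs, hNeq]
    · rw [pow_mul, hs]
      exact le_geometric_of_sq_le_mul (a := fun i => weightedNorm v (u i))
        (fun _ => weightedNorm_nonneg) hu.norm_sq_le_mul hXpos hlampos hNeq hi
    · rw [hs]
      rw [hNeq] at hXY
      -- Iterated Poincaré, X ≤ Λ^N Y = Λ^N X lam^N, divided by X.
      have h1 : 1 ≤ (Λ * lam) ^ N := by
        rw [mul_pow]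
        nlinarith
      by_contra! hlt
      exact absurd h1 (not_le.2 (pow_lt_one₀ (by positivity) hlt hN))

end NeumannJet

end CurveFlow

end

noncomputable section

namespace CurveFlow

/-! ### Differential polynomials -/

/-- Polynomials in the indeterminates `X i`, which stand for the derivatives `u i` of a jet. -/
abbrev JetPoly : Type := MvPolynomial ℕ ℝ

namespace JetPoly

open MvPolynomial

/-- The total derivative `X i ↦ X (i + 1)`. -/
def D : Derivation ℝ JetPoly JetPoly := mkDerivation ℝ fun i => X (i + 1)

lemma D_X (i : ℕ) : D (X i) = X (i + 1) := mkDerivation_X ℝ _ i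

lemma D_mul (p q : JetPoly) : D (p * q) = p * D q + q * D p := by
  simp [Derivation.leibniz]

/-- The monomial with a given multiset of orders. -/
def monom (s : Multiset ℕ) : JetPoly := (s.map X).prod

lemma monom_cons (i : ℕ) (s : Multiset ℕ) : monom (i ::ₘ s) = X i * monom s := by
  simp [monom]

lemma monom_add (s t : Multiset ℕ) : monom (s + t) = monom s * monom t := by
  simp [monom]

/-- Differential polynomials all of whose monomials have degree `d` and weight `w`. -/
def homog (d w : ℕ) : Submodule ℝ JetPoly :=
  Submodule.span ℝ {p | ∃ s : Multiset ℕ, s.card = d ∧ s.sum = w ∧ monom s = p}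

lemma monom_mem {s : Multiset ℕ} {d w : ℕ} (hd : s.card = d) (hw : s.sum = w) :
    monom s ∈ homog d w := Submodule.subset_span ⟨s, hd, hw, rfl⟩

lemma X_mem (i : ℕ) : X i ∈ homog 1 i := by
  simpa [monom] using monom_mem (s := {i}) (d := 1) (w := i) (by simp) (by simp)

lemma homog_mul_mem {d w d' w' : ℕ} {p q : JetPoly} (hp : p ∈ homog d w) (hq : q ∈ homog d' w') :
    p * q ∈ homog (d + d') (w + w') := by
  induction hp using Submodule.span_induction with
  | mem p hp =>
    obtain ⟨s, hs, hs', rfl⟩ := hp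
    induction hq using Submodule.span_induction with
    | mem q hq =>
      obtain ⟨t, ht, ht', rfl⟩ := hq
      rw [← monom_add]
      exact monom_mem (by simp [hs, ht]) (by simp [hs', ht'])
    | zero => simp
    | add a b _ _ ha hb => rw [mul_add]; exact add_mem ha hb
    | smul c a _ ha => rw [mul_smul_comm]; exact Submodule.smul_mem _ _ ha
  | zero => simp
  | add a b _ _ ha hb => rw [add_mul]; exact add_mem ha hb
  | smul c a _ ha => rw [smul_mul_assoc]; exact Submodule.smul_mem _ _ ha

lemma D_monom_mem (s : Multiset ℕ) : D (monom s) ∈ homog s.card (s.sum + 1) := by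
  induction s using Multiset.induction with
  | empty => simp [monom]
  | cons i s ih =>
    rw [monom_cons, D_mul, D_X]
    refine add_mem ?_ ?_
    · have := homog_mul_mem (X_mem i) ih
      rwa [show 1 + s.card = (i ::ₘ s).card by simp [add_comm],
        show i + (s.sum + 1) = (i ::ₘ s).sum + 1 by simp [add_assoc]] at this
    · rw [mul_comm, ← monom_cons]
      exact monom_mem (by simp) (by simp; ring)

lemma D_mem {d w : ℕ} {p : JetPoly} (hp : p ∈ homog d w) : D p ∈ homog d (w + 1) := by
  induction hp using Submodule.span_induction with
  | mem p hp =>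
    obtain ⟨s, rfl, rfl, rfl⟩ := hp
    exact D_monom_mem s
  | zero => simp
  | add a b _ _ ha hb => rw [map_add]; exact add_mem ha hb
  | smul c a _ ha => rw [Derivation.map_smul]; exact Submodule.smul_mem _ _ ha

lemma iterate_D_mem {d w : ℕ} {p : JetPoly} (hp : p ∈ homog d w) (r : ℕ) :
    (⇑D)^[r] p ∈ homog d (w + r) := by
  induction r with
  | zero => exact hp
  | succ r ih => rw [Function.iterate_succ_apply']; exact D_mem ih

/-- An odd sum of orders contains an odd order, and that factor vanishes. This parity argument
disposes of the boundary terms throughout. -/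
lemma eval_eq_zero_of_odd {z : ℕ → ℝ} {d w : ℕ} (hw : Odd w)
    (hz : ∀ i ≤ w, Odd i → z i = 0) {p : JetPoly} (hp : p ∈ homog d w) : eval z p = 0 := by
  induction hp using Submodule.span_induction with
  | mem p hp =>
    obtain ⟨s, -, hs, rfl⟩ := hp
    have hex : ∃ i ∈ s, Odd i := by
      by_contra! hev
      have : 2 ∣ s.sum := Multiset.dvd_sum fun i hi =>
        (Nat.not_odd_iff_even.1 (hev i hi)).two_dvd
      rw [hs] at this
      exact Nat.not_even_iff_odd.2 hw (even_iff_two_dvd.2 this)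
    obtain ⟨i, his, hi⟩ := hex
    obtain ⟨t, rfl⟩ := Multiset.exists_cons_of_mem his
    rw [monom_cons, map_mul, eval_X, hz i (by rw [← hs]; simp) hi, zero_mul]
  | zero => simp
  | add a b _ _ ha hb => rw [map_add, ha, hb, add_zero]
  | smul c a _ ha => rw [smul_eval, ha, mul_zero]

/-- The value of a differential polynomial on a jet. -/
def jetEval (u : ℕ → ℝ → ℝ) (p : JetPoly) (x : ℝ) : ℝ := eval (fun i => u i x) p

variable {v : ℝ → ℝ} {u : ℕ → ℝ → ℝ} {p q : JetPoly}

lemma jetEval_X (i : ℕ) : jetEval u (X i) = u i := by ext; simp [jetEval]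

lemma jetEval_mul (x : ℝ) : jetEval u (p * q) x = jetEval u p x * jetEval u q x := by
  simp [jetEval]

lemma jetEval_add (x : ℝ) : jetEval u (p + q) x = jetEval u p x + jetEval u q x := by
  simp [jetEval]

lemma jetEval_smul (a x : ℝ) : jetEval u (a • p) x = a * jetEval u p x := by
  simp [jetEval, smul_eval]

lemma hasArcDeriv_jetEval (hu : ∀ i, HasArcDeriv v (u i) (u (i + 1))) (p : JetPoly) :
    HasArcDeriv v (jetEval u p) (jetEval u (D p)) := by
  intro x hx
  induction p using MvPolynomial.induction_on with
  | C a =>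
    have h : D (C a) = 0 := MvPolynomial.derivation_C D a
    have h2 : jetEval u (C a) = fun _ => a := by ext; simp [jetEval]
    rw [h, h2]
    simpa [jetEval] using hasDerivWithinAt_const x paramInterval a
  | add p q hp hq =>
    rw [map_add, jetEval_add, mul_add]
    exact (hp.add hq).congr (fun y _ => jetEval_add y) (jetEval_add x)
  | mul_X p i hp =>
    have h := hp.mul (hu i x hx)
    rw [D_mul, D_X, jetEval_add, jetEval_mul, jetEval_mul, jetEval_X, jetEval_X]
    refine (h.congr (fun y _ => ?_) ?_).congr_deriv ?_
    · rw [jetEval_mul, jetEval_X]; rfl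
    · rw [jetEval_mul, jetEval_X]; rfl
    · ring

end JetPoly

open JetPoly

namespace NeumannJet

variable {v : ℝ → ℝ} {u : ℕ → ℝ → ℝ}

lemma continuousOn_jetEval (hu : NeumannJet v u) (p : JetPoly) :
    ContinuousOn (jetEval u p) paramInterval := (hasArcDeriv_jetEval hu.deriv p).continuousOn

lemma jetEval_eq_zero (hu : NeumannJet v u) {d w : ℕ} (hw : Odd w) {p : JetPoly}
    (hp : p ∈ homog d w) {x : ℝ} (hx : x ∈ ({-1, 1} : Set ℝ)) : jetEval u p x = 0 :=
  eval_eq_zero_of_odd hw (fun _ _ hi => hu.eq_zero_of_odd hi hx) hp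

/-- Each of the r integrations by parts has a boundary term of weight one less than the even total
weight, so it vanishes by parity. -/
lemma integral_X_mul_eq (hu : NeumannJet v u) {d : ℕ} (b r : ℕ) {w : ℕ} {q : JetPoly}
    (hq : q ∈ homog d w) (hw : Even (b + r + w)) :
    weightedIntegral v (jetEval u (MvPolynomial.X (b + r) * q)) =
      (-1) ^ r * weightedIntegral v (jetEval u (MvPolynomial.X b * (⇑D)^[r] q)) := by
  induction r generalizing q w with
  | zero => simp
  | succ r ih =>
    rw [Function.iterate_succ_apply, pow_succ, mul_assoc, mul_comm (-1 : ℝ), ← mul_assoc,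
      ← ih (D_mem hq) (by convert hw using 1; ring), mul_neg_one, ← add_assoc]
    have h := (hu.deriv (b + r)).integral_mul_eq_neg hu.speed (hasArcDeriv_jetEval hu.deriv q)
      (hu.cont _) (hu.continuousOn_jetEval _) fun x hx => by
        have := hu.jetEval_eq_zero (w := b + r + w) (by grind) (homog_mul_mem (X_mem (b + r)) hq) hx
        rwa [jetEval_mul, jetEval_X] at this
    have e : ∀ (i : ℕ) (p : JetPoly),
        jetEval u (MvPolynomial.X i * p) = fun x => u i x * jetEval u p x := fun i p => by
      ext x; rw [jetEval_mul, jetEval_X]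
    rw [e, e]
    exact h

end NeumannJet

/-! ### Interpolation bounds for integrals of differential polynomials -/

/-- The integral of a differential polynomial is bounded by `C ‖u 0‖^A μ^B` for all Neumann jets,
where `μ` is the interpolation parameter between the orders `0` and `N`. -/
def JetBound (N A B : ℕ) (p : JetPoly) : Prop :=
  ∃ C : ℝ, 0 ≤ C ∧ ∀ (v : ℝ → ℝ) (u : ℕ → ℝ → ℝ) (μ : ℝ), NeumannJet v u → 0 ≤ μ →
    (∀ i ≤ N, weightedNorm v (u i) ≤ weightedNorm v (u 0) * μ ^ (2 * i)) →
    |weightedIntegral v (jetEval u p)| ≤ C * weightedNorm v (u 0) ^ A * μ ^ B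

namespace JetBound

variable {N A B : ℕ} {p q : JetPoly}

lemma zero : JetBound N A B 0 :=
  ⟨0, le_rfl, fun v u μ _ _ _ => by
    have : jetEval u 0 = fun _ => 0 := by ext; simp [jetEval]
    rw [this, weightedIntegral_zero]; simp⟩

lemma add (hp : JetBound N A B p) (hq : JetBound N A B q) : JetBound N A B (p + q) := by
  obtain ⟨C, hC, hp⟩ := hp
  obtain ⟨C', hC', hq⟩ := hq
  refine ⟨C + C', add_nonneg hC hC', fun v u μ hu hμ h => ?_⟩
  have : jetEval u (p + q) = fun x => jetEval u p x + jetEval u q x := funext jetEval_add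
  rw [this, weightedIntegral_add hu.speed (hu.continuousOn_jetEval _)
    (hu.continuousOn_jetEval _), add_mul, add_mul]
  exact (abs_add_le _ _).trans (add_le_add (hp v u μ hu hμ h) (hq v u μ hu hμ h))

lemma smul (a : ℝ) (hp : JetBound N A B p) : JetBound N A B (a • p) := by
  obtain ⟨C, hC, hp⟩ := hp
  refine ⟨|a| * C, mul_nonneg (abs_nonneg _) hC, fun v u μ hu hμ h => ?_⟩
  have : jetEval u (a • p) = fun x => a * jetEval u p x := funext (jetEval_smul a)
  rw [this, weightedIntegral_const_mul, abs_mul, mul_assoc, mul_assoc, ← mul_assoc C]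
  exact mul_le_mul_of_nonneg_left (hp v u μ hu hμ h) (abs_nonneg _)

/-- Each factor satisfies |u_i| ≤ 2 X μ^(2i+1): the sup bound involves the norms of orders i and i +
1, which is why i < N is needed. -/
lemma abs_jetEval_monom_le {v : ℝ → ℝ} {u : ℕ → ℝ → ℝ} {μ : ℝ} (hu : NeumannJet v u) (hμ : 0 ≤ μ)
    (h : ∀ i ≤ N, weightedNorm v (u i) ≤ weightedNorm v (u 0) * μ ^ (2 * i)) {s : Multiset ℕ}
    (hs : ∀ i ∈ s, i < N) {x : ℝ} (hx : x ∈ paramInterval) :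
    |jetEval u (monom s) x| ≤
      2 ^ s.card * weightedNorm v (u 0) ^ s.card * μ ^ (2 * s.sum + s.card) := by
  have hX : 0 ≤ weightedNorm v (u 0) := weightedNorm_nonneg
  induction s using Multiset.induction with
  | empty => simp [monom, jetEval]
  | cons i s ih =>
    have hi : i < N := hs i (by simp)
    have h1 : |u i x| ≤ 2 * weightedNorm v (u 0) * μ ^ (2 * i + 1) := by
      refine abs_le_of_sq_le_sq ?_ (by positivity)
      calc u i x ^ 2 ≤ 2 * (weightedNorm v (u i) * weightedNorm v (u (i + 1))) := hu.sq_le i hx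
        _ ≤ 2 * ((weightedNorm v (u 0) * μ ^ (2 * i)) *
            (weightedNorm v (u 0) * μ ^ (2 * (i + 1)))) := by
          gcongr
          · exact weightedNorm_nonneg
          · exact h i hi.le
          · exact h (i + 1) hi
        _ = 2 * (weightedNorm v (u 0) ^ 2 * μ ^ (4 * i + 2)) := by ring
        _ ≤ 4 * (weightedNorm v (u 0) ^ 2 * μ ^ (4 * i + 2)) := by
          gcongr; norm_num
        _ = _ := by ring
    have h2 := ih fun j hj => hs j (by simp [hj])
    rw [monom_cons, jetEval_mul, jetEval_X, abs_mul]
    calc |u i x| * |jetEval u (monom s) x|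
        ≤ (2 * weightedNorm v (u 0) * μ ^ (2 * i + 1)) *
          (2 ^ s.card * weightedNorm v (u 0) ^ s.card * μ ^ (2 * s.sum + s.card)) := by
          gcongr
      _ = _ := by simp only [Multiset.card_cons, Multiset.sum_cons]; ring

/-- Two factors are estimated in L² and the others in the sup norm. Only the sup norms cost the
extra half derivative, hence the exponent 2w + d. -/
lemma X_mul_X_mul_monom {c i d w : ℕ} (hc : c ≤ N) (hi : i < N) {s : Multiset ℕ}
    (hs : ∀ i ∈ s, i < N) (hd : s.card = d) (hw : c + i + s.sum = w) :
    JetBound N (d + 2) (2 * w + d) (MvPolynomial.X c * (MvPolynomial.X i * monom s)) := by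
  subst hd hw
  refine ⟨2 ^ s.card, by positivity, fun v u μ hu hμ h => ?_⟩
  have hX : 0 ≤ weightedNorm v (u 0) := weightedNorm_nonneg
  set M := 2 ^ s.card * weightedNorm v (u 0) ^ s.card * μ ^ (2 * s.sum + s.card) with hM
  have hM0 : 0 ≤ M := by positivity
  have hcc := hu.cont c
  have hci := hu.cont i
  calc |weightedIntegral v (jetEval u (MvPolynomial.X c * (MvPolynomial.X i * monom s)))|
      ≤ weightedIntegral v
          (fun x => |jetEval u (MvPolynomial.X c * (MvPolynomial.X i * monom s)) x|) :=
        abs_weightedIntegral_le hu.speed (hu.continuousOn_jetEval _)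
    _ ≤ weightedIntegral v (fun x => M * (|u c x| * |u i x|)) := by
        refine weightedIntegral_mono hu.speed (hu.continuousOn_jetEval _).abs (by fun_prop)
          fun x hx => ?_
        rw [jetEval_mul, jetEval_mul, jetEval_X, jetEval_X, abs_mul, abs_mul, ← mul_assoc,
          mul_comm]
        exact mul_le_mul_of_nonneg_right (abs_jetEval_monom_le hu hμ h hs hx) (by positivity)
    _ = M * weightedIntegral v (fun x => |u c x| * |u i x|) := weightedIntegral_const_mul _
    _ ≤ M * (weightedNorm v (u c) * weightedNorm v (u i)) :=
        mul_le_mul_of_nonneg_left (weightedIntegral_abs_mul_abs_le hu.speed hcc hci) hM0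
    _ ≤ M * ((weightedNorm v (u 0) * μ ^ (2 * c)) * (weightedNorm v (u 0) * μ ^ (2 * i))) := by
        gcongr
        · exact weightedNorm_nonneg
        · exact h c hc
        · exact h i hi.le
    _ = _ := by rw [hM]; ring

lemma X_mul_of_mem {c d w : ℕ} (hc : c ≤ N) (hw : w < N) (hp : p ∈ homog (d + 1) w) :
    JetBound N (d + 2) (2 * (c + w) + d) (MvPolynomial.X c * p) := by
  induction hp using Submodule.span_induction with
  | mem p hp =>
    obtain ⟨s, hd, hs, rfl⟩ := hp
    obtain ⟨i, t, rfl⟩ : ∃ i t, s = i ::ₘ t := by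
      obtain ⟨i, hi⟩ := Multiset.card_pos_iff_exists_mem.1 (by omega : 0 < s.card)
      exact ⟨i, Multiset.exists_cons_of_mem hi⟩
    simp only [Multiset.card_cons, Multiset.sum_cons] at hd hs
    rw [monom_cons]
    refine X_mul_X_mul_monom hc (by omega) (fun j hj => ?_) (by omega) (by omega)
    have := Multiset.le_sum_of_mem hj
    omega
  | zero => rw [mul_zero]; exact zero
  | add a b _ _ ha hb => have := ha.add hb; rwa [← mul_add] at this
  | smul r a _ ha => have := ha.smul r; rwa [← mul_smul_comm] at this

/-- If all orders are below N, this is the previous count of powers. Otherwise one factor has order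
N + r, and its r surplus derivatives are moved to the others. Since w < 2N, the other factors then
have total weight below N. -/
lemma of_mem {d w : ℕ} (hw : Even w) (hwN : w < 2 * N) (hp : p ∈ homog (d + 2) w) :
    JetBound N (d + 2) (2 * w + d) p := by
  induction hp using Submodule.span_induction with
  | mem p hp =>
    obtain ⟨s, hd, hs, rfl⟩ := hp
    by_cases hall : ∀ i ∈ s, i < N
    · obtain ⟨c, t, rfl⟩ : ∃ i t, s = i ::ₘ t := by
        obtain ⟨i, hi⟩ := Multiset.card_pos_iff_exists_mem.1 (by omega : 0 < s.card)
        exact ⟨i, Multiset.exists_cons_of_mem hi⟩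
      simp only [Multiset.card_cons, Multiset.sum_cons] at hd hs
      obtain ⟨i, t, rfl⟩ : ∃ i t', t = i ::ₘ t' := by
        obtain ⟨i, hi⟩ := Multiset.card_pos_iff_exists_mem.1 (by omega : 0 < t.card)
        exact ⟨i, Multiset.exists_cons_of_mem hi⟩
      simp only [Multiset.card_cons, Multiset.sum_cons] at hd hs
      rw [monom_cons, monom_cons]
      exact X_mul_X_mul_monom (hall c (by simp)).le (hall i (by simp))
        (fun j hj => hall j (by simp [hj])) (by omega) (by omega)
    · push Not at hall
      obtain ⟨a, ha, haN⟩ := hall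
      obtain ⟨t, rfl⟩ := Multiset.exists_cons_of_mem ha
      obtain ⟨r, rfl⟩ := Nat.exists_eq_add_of_le haN
      simp only [Multiset.card_cons, Multiset.sum_cons] at hd hs
      have ht : monom t ∈ homog (d + 1) t.sum := monom_mem (by omega) rfl
      obtain ⟨C, hC, hb⟩ := X_mul_of_mem (N := N) le_rfl (w := t.sum + r) (by omega)
        (iterate_D_mem ht r)
      refine ⟨C, hC, fun v u μ hu hμ h => ?_⟩
      rw [monom_cons, hu.integral_X_mul_eq N r ht (by rwa [hs]), abs_mul, abs_pow, abs_neg,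
        abs_one, one_pow, one_mul]
      convert hb v u μ hu hμ h using 3
      omega
  | zero => exact zero
  | add a b _ _ ha hb => exact ha.add hb
  | smul c a _ ha => exact ha.smul c

end JetBound

/-! ### The normal speed as a differential polynomial -/

/-- The cubic part of the normal speed. -/
def cubicPart (m : ℕ) : JetPoly :=
  - ∑ j ∈ Finset.Icc 1 m, (-1 : ℝ) ^ j •
      (MvPolynomial.X 0 * (MvPolynomial.X (m + j) * MvPolynomial.X (m - j)))
    - (1 / 2 : ℝ) • (MvPolynomial.X 0 * (MvPolynomial.X m * MvPolynomial.X m))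

/-- The normal speed as a differential polynomial in the curvature. -/
def speedPoly (m : ℕ) : JetPoly :=
  (-1 : ℝ) ^ (m + 1) • MvPolynomial.X (2 * m + 2) + cubicPart m

lemma cubicPart_mem (m : ℕ) : cubicPart m ∈ homog 3 (2 * m) := by
  refine sub_mem (neg_mem (sum_mem fun j hj => Submodule.smul_mem _ _ ?_))
    (Submodule.smul_mem _ _ ?_)
  · have hj' := (Finset.mem_Icc.1 hj).2
    have := homog_mul_mem (X_mem 0) (homog_mul_mem (X_mem (m + j)) (X_mem (m - j)))
    convert this using 1
    congr 1
    omega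
  · convert homog_mul_mem (X_mem 0) (homog_mul_mem (X_mem m) (X_mem m)) using 1
    congr 1
    omega

lemma eval_speedPoly (m : ℕ) (z : ℕ → ℝ) :
    MvPolynomial.eval z (speedPoly m) = (-1) ^ (m + 1) * z (2 * m + 2)
      - ∑ j ∈ Finset.Icc 1 m, (-1) ^ j * (z 0 * z (m + j) * z (m - j))
      - 1 / 2 * (z 0 * z m ^ 2) := by
  simp only [speedPoly, cubicPart, map_add, map_sub, map_neg, map_sum, MvPolynomial.smul_eval,
    map_mul, MvPolynomial.eval_X]
  simp only [mul_assoc, sq]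
  ring

end CurveFlow

end

noncomputable section

namespace CurveFlow

/-! ### Rotation in the plane -/

lemma inner_plane (u w : Plane) : inner ℝ u w = u 0 * w 0 + u 1 * w 1 := by
  simp [PiLp.inner_apply, Fin.sum_univ_two, mul_comm]

/-- The rotation by a right angle as a continuous linear map. -/
def rotCLM : Plane →L[ℝ] Plane :=
  LinearMap.toContinuousLinearMap
    { toFun := rot
      map_add' := fun u w => by ext i; fin_cases i <;> simp [rot]; ring
      map_smul' := fun a u => by ext i; fin_cases i <;> simp [rot] }

lemma rotCLM_apply (u : Plane) : rotCLM u = rot u := rfl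

lemma rot_smul (a : ℝ) (u : Plane) : rot (a • u) = a • rot u := rotCLM.map_smul a u

lemma rot_rot (u : Plane) : rot (rot u) = -u := by
  ext i; fin_cases i <;> simp [rot]

lemma inner_rot_rot (u w : Plane) : inner ℝ (rot u) (rot w) = inner ℝ u w := by
  simp [inner_plane, rot]; ring

lemma inner_rot_right_self (u : Plane) : inner ℝ u (rot u) = 0 := by
  simp [inner_plane, rot]; ring

lemma inner_sq_add_inner_rot_sq (u w : Plane) :
    inner ℝ u w ^ 2 + inner ℝ u (rot w) ^ 2 = inner ℝ u u * inner ℝ w w := by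
  simp only [inner_plane]; simp [rot]; ring

lemma eq_inner_smul_rot {u w : Plane} (hu : inner ℝ u u = 1) (h : inner ℝ w u = 0) :
    w = inner ℝ w (rot u) • rot u := by
  simp only [inner_plane] at hu h
  ext i
  fin_cases i
  · simp [inner_plane, rot]
    linear_combination (u 0) * h - (w 0) * hu
  · simp [inner_plane, rot]
    linear_combination (u 1) * h - (w 1) * hu

/-! ### Arclength derivatives -/

section ArcDeriv

variable {E : Type*} [NormedAddCommGroup E] [NormedSpace ℝ E] {c : ℝ → Plane} {x : ℝ}

lemma arcDeriv_congr {f g : ℝ → E} (h : ∀ y ∈ paramInterval, f y = g y) (hx : x ∈ paramInterval) :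
    arcDeriv c f x = arcDeriv c g x := by
  rw [arcDeriv, arcDeriv, derivWithin_congr h (h x hx)]

lemma arcDeriv_eq_of_hasDerivWithinAt {f : ℝ → E} {f' : E} (hc : speed c x ≠ 0)
    (hf : HasDerivWithinAt f (speed c x • f') paramInterval x) (hx : x ∈ paramInterval) :
    arcDeriv c f x = f' := by
  rw [arcDeriv, hf.derivWithin (uniqueDiffOn_paramInterval x hx), inv_smul_smul₀ hc]

lemma inner_unitTangent_unitNormal :
    inner ℝ (unitTangent c x) (unitNormal c x) = 0 := inner_rot_right_self _

lemma curvatureDeriv_succ (c : ℝ → Plane) (ℓ : ℕ) :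
    curvatureDeriv c (ℓ + 1) = arcDeriv c (curvatureDeriv c ℓ) := by
  rw [curvatureDeriv, curvatureDeriv, Function.iterate_succ_apply']

end ArcDeriv

lemma normalSpeed_eq_jetEval (m : ℕ) (c : ℝ → Plane) (x : ℝ) :
    normalSpeed m c x = JetPoly.jetEval (curvatureDeriv c) (speedPoly m) x :=
  (eval_speedPoly m fun i => curvatureDeriv c i x).symm

lemma isTimeInterval_timeInterval {T : EReal} (hT : 0 < T) : IsTimeInterval (timeInterval T) where
  convex := by
    rw [convex_iff_ordConnected]
    exact ⟨fun a ha b hb c hc =>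
      ⟨ha.1.trans hc.1, lt_of_le_of_lt (EReal.coe_le_coe_iff.2 hc.2) hb.2⟩⟩
  nonempty := by
    obtain ⟨s, hs0, hsT⟩ := EReal.lt_iff_exists_real_btwn.1 hT
    have hs0' : 0 < s := EReal.coe_pos.1 hs0
    refine ⟨s / 2, mem_interior_iff_mem_nhds.2 ?_⟩
    filter_upwards [Ioo_mem_nhds (half_pos hs0') (half_lt_self hs0')] with r hr
    exact ⟨hr.1.le, lt_trans (EReal.coe_lt_coe_iff.2 hr.2) hsT⟩

/-! ### Evolution equations -/

namespace IsSolution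

variable {m : ℕ} {e : Plane} {a b : ℝ} {T : EReal} {γ : ℝ → ℝ → Plane}
  (h : IsSolution m e a b T γ)
include h

lemma speed_pos {t x : ℝ} (ht : t ∈ timeInterval T) (hx : x ∈ paramInterval) : 0 < speed (γ t) x :=
  norm_pos_iff.2 (h.regular t ht x hx)

lemma smoothFamily : SmoothFamily (timeInterval T) γ := h.smooth

variable (hT : 0 < T)
include hT

lemma smoothFamily_speed : SmoothFamily (timeInterval T) fun t x => speed (γ t) x :=
  ContDiffOn.norm ℝ (h.smoothFamily.dSpace (isTimeInterval_timeInterval hT))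
    fun p hp => h.regular p.1 hp.1 p.2 hp.2

lemma smoothFamily_inv_speed : SmoothFamily (timeInterval T) fun t x => (speed (γ t) x)⁻¹ :=
  (h.smoothFamily_speed hT).inv fun _ ht _ hx => (h.speed_pos ht hx).ne'

section

variable {E : Type*} [NormedAddCommGroup E] [NormedSpace ℝ E] {f : ℝ → ℝ → E}

lemma smoothFamily_arcDeriv (hf : SmoothFamily (timeInterval T) f) :
    SmoothFamily (timeInterval T) fun t => arcDeriv (γ t) (f t) :=
  (h.smoothFamily_inv_speed hT).smul (hf.dSpace (isTimeInterval_timeInterval hT))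

omit hT in
lemma dSpace_eq {t x : ℝ} (ht : t ∈ timeInterval T) (hx : x ∈ paramInterval) :
    dSpace f t x = speed (γ t) x • arcDeriv (γ t) (f t) x := by
  rw [arcDeriv, smul_inv_smul₀ (h.speed_pos ht hx).ne']; rfl

omit hT in
lemma hasDerivWithinAt_arcDeriv (hf : SmoothFamily (timeInterval T) f) {t x : ℝ} (ht : t ∈ timeInterval T)
    (hx : x ∈ paramInterval) :
    HasDerivWithinAt (f t) (speed (γ t) x • arcDeriv (γ t) (f t) x) paramInterval x := by
  rw [← h.dSpace_eq ht hx]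
  exact hf.hasDerivWithinAt_space ht hx

end

lemma smoothFamily_unitTangent : SmoothFamily (timeInterval T) fun t => unitTangent (γ t) :=
  h.smoothFamily_arcDeriv hT h.smoothFamily

lemma smoothFamily_unitNormal : SmoothFamily (timeInterval T) fun t => unitNormal (γ t) :=
  rotCLM.contDiff.comp_contDiffOn (h.smoothFamily_unitTangent hT)

lemma smoothFamily_curvatureDeriv (ℓ : ℕ) : SmoothFamily (timeInterval T) fun t => curvatureDeriv (γ t) ℓ := by
  induction ℓ with
  | zero =>
    exact ContDiffOn.inner ℝ (h.smoothFamily_arcDeriv hT (h.smoothFamily_unitTangent hT))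
      (h.smoothFamily_unitNormal hT)
  | succ ℓ ih => simpa only [curvatureDeriv_succ] using h.smoothFamily_arcDeriv hT ih

lemma smoothFamily_jetEval (p : JetPoly) :
    SmoothFamily (timeInterval T) fun t => JetPoly.jetEval (curvatureDeriv (γ t)) p := by
  induction p using MvPolynomial.induction_on with
  | C r =>
    exact (SmoothFamily.const (I := timeInterval T) r).congr fun t _ x _ => by
      simp [JetPoly.jetEval]
  | add p q hp hq => exact (hp.add hq).congr fun t _ x _ => JetPoly.jetEval_add x
  | mul_X p i hp =>
    refine (hp.mul (h.smoothFamily_curvatureDeriv hT i)).congr fun t _ x _ => ?_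
    rw [JetPoly.jetEval_mul, JetPoly.jetEval_X]

lemma smoothFamily_normalSpeed : SmoothFamily (timeInterval T) fun t => normalSpeed m (γ t) :=
  (h.smoothFamily_jetEval hT (speedPoly m)).congr fun t _ x _ => normalSpeed_eq_jetEval m (γ t) x

variable {t x : ℝ} (ht : t ∈ timeInterval T)
include ht

omit hT in
lemma inner_unitTangent_self (hx : x ∈ paramInterval) :
    inner ℝ (unitTangent (γ t) x) (unitTangent (γ t) x) = 1 := by
  have hp := h.speed_pos ht hx
  rw [real_inner_self_eq_norm_sq, unitTangent, arcDeriv, norm_smul, norm_inv, Real.norm_eq_abs,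
    abs_of_pos hp]
  change ((speed (γ t) x)⁻¹ * speed (γ t) x) ^ 2 = 1
  rw [inv_mul_cancel₀ hp.ne', one_pow]

omit hT in
lemma inner_unitNormal_self (hx : x ∈ paramInterval) :
    inner ℝ (unitNormal (γ t) x) (unitNormal (γ t) x) = 1 := by
  rw [unitNormal, inner_rot_rot, h.inner_unitTangent_self ht hx]

/-- Differentiating |τ|² = 1 shows that τ_s is orthogonal to τ, hence a multiple of ν. -/
lemma arcDeriv_unitTangent (hx : x ∈ paramInterval) :
    arcDeriv (γ t) (unitTangent (γ t)) x = curvature (γ t) x • unitNormal (γ t) x := by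
  refine eq_inner_smul_rot (h.inner_unitTangent_self ht hx) ?_
  have h1 := h.hasDerivWithinAt_arcDeriv (h.smoothFamily_unitTangent hT) ht hx
  have h2 := h1.inner ℝ h1
  have h3 := (hasDerivWithinAt_const x paramInterval (1 : ℝ)).congr
    (fun y hy => h.inner_unitTangent_self ht hy) (h.inner_unitTangent_self ht hx)
  have h4 := (uniqueDiffOn_paramInterval x hx).eq_deriv _ h2 h3
  rw [real_inner_comm (unitTangent (γ t) x), inner_smul_right, real_inner_comm] at h4
  have := (h.speed_pos ht hx).ne'
  have h5 : speed (γ t) x * inner ℝ (arcDeriv (γ t) (unitTangent (γ t)) x)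
    (unitTangent (γ t) x) = 0 := by linarith
  exact (mul_eq_zero.1 h5).resolve_left this

lemma arcDeriv_unitNormal (hx : x ∈ paramInterval) :
    arcDeriv (γ t) (unitNormal (γ t)) x = -(curvature (γ t) x • unitTangent (γ t) x) := by
  refine arcDeriv_eq_of_hasDerivWithinAt (h.speed_pos ht hx).ne' ?_ hx
  have h1 := rotCLM.hasFDerivAt.comp_hasDerivWithinAt x
    (h.hasDerivWithinAt_arcDeriv (h.smoothFamily_unitTangent hT) ht hx)
  refine h1.congr_deriv ?_
  rw [rotCLM_apply, h.arcDeriv_unitTangent hT ht hx, rot_smul, rot_smul, unitNormal, rot_rot,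
    smul_neg]

/-- The arclength derivative of `f ν`. -/
lemma arcDeriv_smul_unitNormal {f : ℝ → ℝ → ℝ} (hf : SmoothFamily (timeInterval T) f) (hx : x ∈ paramInterval) :
    arcDeriv (γ t) (fun y => f t y • unitNormal (γ t) y) x =
      arcDeriv (γ t) (f t) x • unitNormal (γ t) x
        - (f t x * curvature (γ t) x) • unitTangent (γ t) x := by
  refine arcDeriv_eq_of_hasDerivWithinAt (h.speed_pos ht hx).ne' ?_ hx
  have h1 := (h.hasDerivWithinAt_arcDeriv hf ht hx).smul
    (h.hasDerivWithinAt_arcDeriv (h.smoothFamily_unitNormal hT) ht hx)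
  refine h1.congr_deriv ?_
  rw [h.arcDeriv_unitNormal hT ht hx]
  module

omit hT in
lemma dSpace_eq_smul_unitTangent (hx : x ∈ paramInterval) :
    dSpace γ t x = speed (γ t) x • unitTangent (γ t) x := h.dSpace_eq ht hx

lemma dTime_self (hx : x ∈ paramInterval) :
    dTime (timeInterval T) γ t x = normalSpeed m (γ t) x • unitNormal (γ t) x :=
  (h.flow t ht x hx).derivWithin ((isTimeInterval_timeInterval hT).uniqueDiffOn t ht)

lemma dTime_dSpace (hx : x ∈ paramInterval) :
    dTime (timeInterval T) (dSpace γ) t x = speed (γ t) x •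
      (arcDeriv (γ t) (normalSpeed m (γ t)) x • unitNormal (γ t) x
        - (normalSpeed m (γ t) x * curvature (γ t) x) • unitTangent (γ t) x) := by
  rw [← h.smoothFamily.dSpace_dTime_comm (isTimeInterval_timeInterval hT) ht hx,
    h.dSpace_eq ht hx, arcDeriv_congr (fun y hy => h.dTime_self hT ht hy) hx,
    h.arcDeriv_smul_unitNormal hT ht (h.smoothFamily_normalSpeed hT) hx]

lemma hasDerivWithinAt_dSpace (hx : x ∈ paramInterval) :
    HasDerivWithinAt (fun r => dSpace γ r x) (speed (γ t) x •
      (arcDeriv (γ t) (normalSpeed m (γ t)) x • unitNormal (γ t) x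
        - (normalSpeed m (γ t) x * curvature (γ t) x) • unitTangent (γ t) x)) (timeInterval T) t := by
  rw [← h.dTime_dSpace hT ht hx]
  exact (h.smoothFamily.dSpace (isTimeInterval_timeInterval hT)).hasDerivWithinAt_time ht hx

/-- Differentiate |γ_x|² in two ways. Only the tangential part -F k τ of the arclength derivative of
F ν contributes. -/
lemma hasDerivWithinAt_speed (hx : x ∈ paramInterval) :
    HasDerivWithinAt (fun r => speed (γ r) x)
      (-(curvature (γ t) x * normalSpeed m (γ t) x * speed (γ t) x)) (timeInterval T) t := by
  have hp := h.speed_pos ht hx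
  have hd := (h.smoothFamily_speed hT).hasDerivWithinAt_time ht hx
  refine hd.congr_deriv ?_
  have h1 := h.hasDerivWithinAt_dSpace hT ht hx
  have h2 := h1.inner ℝ h1
  have h3 := (hd.mul hd).congr (f₁ := fun r => inner ℝ (dSpace γ r x) (dSpace γ r x))
    (fun r _ => real_inner_self_eq_norm_mul_norm _) (real_inner_self_eq_norm_mul_norm _)
  have h4 := ((isTimeInterval_timeInterval hT).uniqueDiffOn t ht).eq_deriv _ h2 h3
  rw [h.dSpace_eq_smul_unitTangent ht hx, real_inner_comm (speed (γ t) x • unitTangent (γ t) x)]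
    at h4
  simp only [inner_smul_left, inner_smul_right, inner_sub_right,
    inner_unitTangent_unitNormal, h.inner_unitTangent_self ht hx, conj_trivial] at h4
  have hp2 : (2 * speed (γ t) x) ≠ 0 := by positivity
  apply mul_left_cancel₀ hp2
  linarith

lemma hasDerivWithinAt_inv_speed (hx : x ∈ paramInterval) :
    HasDerivWithinAt (fun r => (speed (γ r) x)⁻¹)
      (curvature (γ t) x * normalSpeed m (γ t) x * (speed (γ t) x)⁻¹) (timeInterval T) t := by
  have hp := (h.speed_pos ht hx).ne'
  refine ((h.hasDerivWithinAt_speed hT ht hx).inv hp).congr_deriv ?_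
  field_simp

/-- The commutator of the time derivative with the arclength derivative. -/
lemma hasDerivWithinAt_arcDeriv_time {E : Type*} [NormedAddCommGroup E] [NormedSpace ℝ E]
    {f : ℝ → ℝ → E} (hf : SmoothFamily (timeInterval T) f) (hx : x ∈ paramInterval) :
    HasDerivWithinAt (fun r => arcDeriv (γ r) (f r) x)
      (arcDeriv (γ t) (dTime (timeInterval T) f t) x +
        (curvature (γ t) x * normalSpeed m (γ t) x) • arcDeriv (γ t) (f t) x) (timeInterval T) t := by
  have hI := isTimeInterval_timeInterval hT
  have h1 := (h.hasDerivWithinAt_inv_speed hT ht hx).smul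
    ((hf.dSpace hI).hasDerivWithinAt_time ht hx)
  rw [← hf.dSpace_dTime_comm hI ht hx] at h1
  refine h1.congr_deriv ?_
  rw [arcDeriv, arcDeriv, smul_smul]
  rfl

lemma hasDerivWithinAt_unitTangent (hx : x ∈ paramInterval) :
    HasDerivWithinAt (fun r => unitTangent (γ r) x)
      (arcDeriv (γ t) (normalSpeed m (γ t)) x • unitNormal (γ t) x) (timeInterval T) t := by
  refine (h.hasDerivWithinAt_arcDeriv_time hT ht h.smoothFamily hx).congr_deriv ?_
  rw [arcDeriv_congr (fun y hy => h.dTime_self hT ht hy) hx,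
    h.arcDeriv_smul_unitNormal hT ht (h.smoothFamily_normalSpeed hT) hx]
  change _ - _ + _ • unitTangent (γ t) x = _
  module

lemma hasDerivWithinAt_unitNormal (hx : x ∈ paramInterval) :
    HasDerivWithinAt (fun r => unitNormal (γ r) x)
      (-(arcDeriv (γ t) (normalSpeed m (γ t)) x • unitTangent (γ t) x)) (timeInterval T) t := by
  refine (rotCLM.hasFDerivAt.comp_hasDerivWithinAt t
    (h.hasDerivWithinAt_unitTangent hT ht hx)).congr_deriv ?_
  rw [rotCLM_apply, rot_smul, unitNormal, rot_rot, smul_neg]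

lemma hasDerivWithinAt_curvature (hx : x ∈ paramInterval) :
    HasDerivWithinAt (fun r => curvature (γ r) x)
      (arcDeriv (γ t) (arcDeriv (γ t) (normalSpeed m (γ t))) x
        + curvature (γ t) x ^ 2 * normalSpeed m (γ t) x) (timeInterval T) t := by
  have hI := isTimeInterval_timeInterval hT
  have hFs := h.smoothFamily_arcDeriv hT (h.smoothFamily_normalSpeed hT)
  have h1 := h.hasDerivWithinAt_arcDeriv_time hT ht (h.smoothFamily_unitTangent hT) hx
  have h2 : arcDeriv (γ t) (dTime (timeInterval T) (fun t => unitTangent (γ t)) t) x =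
      arcDeriv (γ t) (fun y => arcDeriv (γ t) (normalSpeed m (γ t)) y • unitNormal (γ t) y) x :=
    arcDeriv_congr (fun y hy =>
      (h.hasDerivWithinAt_unitTangent hT ht hy).derivWithin (hI.uniqueDiffOn t ht)) hx
  rw [h2, h.arcDeriv_smul_unitNormal hT ht hFs hx] at h1
  refine (h1.inner ℝ (h.hasDerivWithinAt_unitNormal hT ht hx)).congr_deriv ?_
  rw [h.arcDeriv_unitTangent hT ht hx]
  simp only [inner_smul_left, inner_smul_right, inner_add_left, inner_sub_left, inner_neg_right,
    real_inner_comm (unitTangent (γ t) x) (unitNormal (γ t) x),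
    inner_unitTangent_unitNormal, h.inner_unitNormal_self ht hx, conj_trivial]
  ring

end IsSolution

end CurveFlow

end

/-! ### Time derivatives of the curvature and boundary conditions of all odd orders -/

noncomputable section

namespace CurveFlow

open JetPoly

/-- The time derivatives of the derivatives of the curvature, as differential polynomials. -/
def timePoly (m : ℕ) : ℕ → JetPoly
  | 0 => D (D (speedPoly m)) + MvPolynomial.X 0 * MvPolynomial.X 0 * speedPoly m
  | ℓ + 1 => D (timePoly m ℓ) + MvPolynomial.X 0 * speedPoly m * MvPolynomial.X (ℓ + 1)

lemma mul_speedPoly_mem (m : ℕ) {d w : ℕ} {p : JetPoly} (hp : p ∈ homog d w) :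
    ∃ A ∈ homog (d + 1) (w + (2 * m + 2)), ∃ B ∈ homog (d + 3) (w + 2 * m),
      p * speedPoly m = A + B := by
  have hX : (-1 : ℝ) ^ (m + 1) • MvPolynomial.X (2 * m + 2) ∈ homog 1 (2 * m + 2) :=
    Submodule.smul_mem _ _ (X_mem _)
  exact ⟨_, homog_mul_mem hp hX, _, homog_mul_mem hp (cubicPart_mem m), by
    rw [speedPoly, mul_add]⟩

/-- Every weight that occurs has the parity of ℓ, and the single linear term carries the highest
order. An odd ℓ therefore turns u_ℓ = 0 at the ends into a condition on that highest order. -/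
lemma timePoly_eq (m ℓ : ℕ) :
    ∃ A ∈ homog 3 (2 * m + 2 + ℓ), ∃ B ∈ homog 5 (2 * m + ℓ),
      timePoly m ℓ = (-1 : ℝ) ^ (m + 1) • MvPolynomial.X (2 * m + 4 + ℓ) + A + B := by
  induction ℓ with
  | zero =>
    obtain ⟨A, hA, B, hB, hAB⟩ := mul_speedPoly_mem m (homog_mul_mem (X_mem 0) (X_mem 0))
    refine ⟨D (D (cubicPart m)) + A, add_mem (D_mem (D_mem (cubicPart_mem m))) ?_, B, ?_, ?_⟩
    · simpa using hA
    · simpa using hB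
    · rw [timePoly, hAB, speedPoly, map_add, map_add, Derivation.map_smul, Derivation.map_smul,
        D_X, D_X]
      simp only [add_zero]
      abel
  | succ ℓ ih =>
    obtain ⟨A, hA, B, hB, hAB⟩ := ih
    obtain ⟨A', hA', B', hB', hAB'⟩ :=
      mul_speedPoly_mem m (homog_mul_mem (X_mem 0) (X_mem (ℓ + 1)))
    refine ⟨D A + A', add_mem (D_mem hA) ?_, D B + B', add_mem (D_mem hB) ?_, ?_⟩
    · convert hA' using 1
      congr 1
      omega
    · convert hB' using 1
      congr 1
      omega
    · rw [timePoly, mul_right_comm, hAB', hAB, map_add, map_add, Derivation.map_smul, D_X,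
        ← add_assoc (2 * m + 4)]
      abel

lemma D_speedPoly_eq (m : ℕ) : ∃ A ∈ homog 3 (2 * m + 1),
    D (speedPoly m) = (-1 : ℝ) ^ (m + 1) • MvPolynomial.X (2 * m + 3) + A :=
  ⟨D (cubicPart m), D_mem (cubicPart_mem m), by
    rw [speedPoly, map_add, Derivation.map_smul, D_X]⟩

namespace IsSolution

variable {m : ℕ} {e : Plane} {a b : ℝ} {T : EReal} {γ : ℝ → ℝ → Plane}
  (h : IsSolution m e a b T γ) (hT : 0 < T)
include h hT

lemma isSpeed {t : ℝ} (ht : t ∈ timeInterval T) : IsSpeed (speed (γ t)) where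
  cont := (h.smoothFamily_speed hT).continuousOn_space ht
  pos := fun _ hx => h.speed_pos ht hx

lemma hasArcDeriv_curvatureDeriv {t : ℝ} (ht : t ∈ timeInterval T) (i : ℕ) :
    HasArcDeriv (speed (γ t)) (curvatureDeriv (γ t) i) (curvatureDeriv (γ t) (i + 1)) := by
  intro x hx
  rw [curvatureDeriv_succ]
  exact h.hasDerivWithinAt_arcDeriv (h.smoothFamily_curvatureDeriv hT i) ht hx

lemma arcDeriv_jetEval {t x : ℝ} (ht : t ∈ timeInterval T) (p : JetPoly)
    (hx : x ∈ paramInterval) :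
    arcDeriv (γ t) (jetEval (curvatureDeriv (γ t)) p) x =
      jetEval (curvatureDeriv (γ t)) (D p) x :=
  arcDeriv_eq_of_hasDerivWithinAt (h.speed_pos ht hx).ne'
    (hasArcDeriv_jetEval (h.hasArcDeriv_curvatureDeriv hT ht) p x hx) hx

omit h hT in
lemma normalSpeed_eq (t : ℝ) :
    normalSpeed m (γ t) = jetEval (curvatureDeriv (γ t)) (speedPoly m) :=
  funext (normalSpeed_eq_jetEval m (γ t))

lemma hasDerivWithinAt_curvatureDeriv {t x : ℝ} (ht : t ∈ timeInterval T)
    (hx : x ∈ paramInterval) (ℓ : ℕ) :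
    HasDerivWithinAt (fun r => curvatureDeriv (γ r) ℓ x)
      (jetEval (curvatureDeriv (γ t)) (timePoly m ℓ) x) (timeInterval T) t := by
  have hI := isTimeInterval_timeInterval hT
  induction ℓ generalizing x with
  | zero =>
    refine (h.hasDerivWithinAt_curvature hT ht hx).congr_deriv ?_
    rw [normalSpeed_eq, arcDeriv_congr (fun y hy => h.arcDeriv_jetEval hT ht _ hy) hx,
      h.arcDeriv_jetEval hT ht _ hx, timePoly, jetEval_add, jetEval_mul, jetEval_mul, jetEval_X,
      sq]
    rfl
  | succ ℓ ih =>
    simp only [curvatureDeriv_succ]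
    refine (h.hasDerivWithinAt_arcDeriv_time hT ht (h.smoothFamily_curvatureDeriv hT ℓ)
      hx).congr_deriv ?_
    have hcongr : ∀ y ∈ paramInterval,
        dTime (timeInterval T) (fun t => curvatureDeriv (γ t) ℓ) t y =
          jetEval (curvatureDeriv (γ t)) (timePoly m ℓ) y :=
      fun y hy => (ih hy).derivWithin (hI.uniqueDiffOn t ht)
    rw [arcDeriv_congr hcongr hx, h.arcDeriv_jetEval hT ht _ hx, normalSpeed_eq, ← curvatureDeriv_succ, timePoly, jetEval_add,
      jetEval_mul, jetEval_mul, jetEval_X, jetEval_X, smul_eq_mul]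
    rfl

/-- The first new boundary condition, from differentiating the orthogonality in time. -/
lemma jetEval_D_speedPoly_eq_zero (he : ‖e‖ = 1) {t x : ℝ} (ht : t ∈ timeInterval T)
    (hx : x ∈ ({-1, 1} : Set ℝ)) :
    jetEval (curvatureDeriv (γ t)) (D (speedPoly m)) x = 0 := by
  have hx' := mem_paramInterval_of_mem_ends hx
  have h1 := (h.hasDerivWithinAt_unitTangent hT ht hx').inner ℝ
    (hasDerivWithinAt_const t (timeInterval T) (rot e))
  have h2 := (hasDerivWithinAt_const t (timeInterval T) (0 : ℝ)).congr
    (fun r hr => h.orthogonal r hr x hx) (h.orthogonal t ht x hx)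
  have h3 := ((isTimeInterval_timeInterval hT).uniqueDiffOn t ht).eq_deriv _ h1 h2
  rw [inner_zero_right, zero_add, inner_smul_left, unitNormal, inner_rot_rot, conj_trivial,
    normalSpeed_eq, h.arcDeriv_jetEval hT ht _ hx'] at h3
  -- The time derivative of ⟨τ, rot e⟩ is F_s ⟨τ, e⟩. Orthogonality makes τ parallel to e, so the
  -- second factor is ±1 and F_s must vanish.
  have h4 := inner_sq_add_inner_rot_sq (unitTangent (γ t) x) e
  rw [h.orthogonal t ht x hx, h.inner_unitTangent_self ht hx', real_inner_self_eq_norm_sq, he]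
    at h4
  refine (mul_eq_zero.1 h3).resolve_right fun h5 => ?_
  rw [h5] at h4
  norm_num at h4

/-- All odd derivatives of the curvature vanish at the ends. -/
lemma curvatureDeriv_odd_eq_zero (he : ‖e‖ = 1) (i : ℕ) {t x : ℝ} (ht : t ∈ timeInterval T)
    (hx : x ∈ ({-1, 1} : Set ℝ)) : curvatureDeriv (γ t) (2 * i + 1) x = 0 := by
  -- The induction treats all times at once, because the boundary conditions already known are
  -- differentiated in time.
  suffices key : ∀ n, ∀ i ≤ m + 1 + n, ∀ t ∈ timeInterval T,
      curvatureDeriv (γ t) (2 * i + 1) x = 0 from key i i (by omega) t ht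
  have hx' := mem_paramInterval_of_mem_ends hx
  have hsign : ((-1 : ℝ) ^ (m + 1)) ≠ 0 := by simp
  intro n
  induction n with
  | zero =>
    intro i hi t ht
    rcases Nat.lt_or_ge m i with hmi | hmi
    · obtain rfl : i = m + 1 := by omega
      obtain ⟨A, hA, hD⟩ := D_speedPoly_eq m
      have h1 := h.jetEval_D_speedPoly_eq_zero hT he ht hx
      have hA0 : jetEval (curvatureDeriv (γ t)) A x = 0 :=
        eval_eq_zero_of_odd (by simp) (fun j hj hodd => by
          obtain ⟨r, rfl⟩ := hodd
          exact h.odd_deriv t ht x hx r (by omega)) hA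
      rw [hD, jetEval_add, hA0, add_zero, jetEval_smul, jetEval_X] at h1
      exact (mul_eq_zero.1 h1).resolve_left hsign
    · exact h.odd_deriv t ht x hx i hmi
  | succ n ih =>
    intro i hi t ht
    rcases Nat.lt_or_ge (m + 1 + n) i with hmi | hmi
    · obtain rfl : i = m + 1 + n + 1 := by omega
      -- The time derivative of u_{2n+1} = 0 has linear term of order 2m + 4 + (2n + 1), which is
      -- the new odd order. The nonlinear terms have odd weight and involve only orders already
      -- treated.
      obtain ⟨A, hA, B, hB, hD⟩ := timePoly_eq m (2 * n + 1)
      have h1 := h.hasDerivWithinAt_curvatureDeriv hT ht hx' (2 * n + 1)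
      have h2 := (hasDerivWithinAt_const t (timeInterval T) (0 : ℝ)).congr
        (fun r hr => ih n (by omega) r hr) (ih n (by omega) t ht)
      have h3 := ((isTimeInterval_timeInterval hT).uniqueDiffOn t ht).eq_deriv _ h1 h2
      have hz : ∀ j ≤ 2 * m + 2 + (2 * n + 1), Odd j → curvatureDeriv (γ t) j x = 0 :=
        fun j hj hodd => by
          obtain ⟨r, rfl⟩ := hodd
          exact ih r (by omega) t ht
      have hA0 : jetEval (curvatureDeriv (γ t)) A x = 0 :=
        eval_eq_zero_of_odd (by grind) hz hA
      have hB0 : jetEval (curvatureDeriv (γ t)) B x = 0 :=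
        eval_eq_zero_of_odd (by grind) (fun j hj => hz j (by omega)) hB
      rw [hD, jetEval_add, jetEval_add, hA0, hB0, add_zero, add_zero, jetEval_smul,
        jetEval_X] at h3
      rw [show 2 * (m + 1 + n + 1) + 1 = 2 * m + 4 + (2 * n + 1) by ring]
      exact (mul_eq_zero.1 h3).resolve_left hsign
    · exact ih i hmi t ht

/-- The derivative of an arclength integral along the flow. -/
lemma hasDerivAt_weightedIntegral {f : ℝ → ℝ → ℝ} {f' : ℝ → ℝ} (hf : SmoothFamily (timeInterval T) f)
    {t : ℝ} (ht : t ∈ interior (timeInterval T))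
    (hf' : ∀ x ∈ paramInterval,
      HasDerivWithinAt (fun r => f r x) (f' x) (timeInterval T) t) :
    HasDerivAt (fun r => weightedIntegral (speed (γ r)) (f r))
      (weightedIntegral (speed (γ t))
        fun x => f' x - curvature (γ t) x * normalSpeed m (γ t) x * f t x) t := by
  have hI := isTimeInterval_timeInterval hT
  have ht' := interior_subset ht
  have h1 := (hf.mul (h.smoothFamily_speed hT)).hasDerivAt_integral hI ht
  refine h1.congr_deriv (intervalIntegral.integral_congr fun x hx => ?_)
  have hx' : x ∈ paramInterval := uIcc_eq_paramInterval ▸ hx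
  have h2 := ((hf' x hx').mul (h.hasDerivWithinAt_speed hT ht' hx')).derivWithin
    (hI.uniqueDiffOn t ht')
  refine Eq.trans h2 ?_
  ring

lemma continuousOn_weightedIntegral {f : ℝ → ℝ → ℝ} (hf : SmoothFamily (timeInterval T) f)
    {s : ℝ} (hs : s ∈ timeInterval T) :
    ContinuousOn (fun r => weightedIntegral (speed (γ r)) (f r)) (Set.Icc 0 s) :=
  continuousOn_integral (hf.mul (h.smoothFamily_speed hT)).continuousOn_prod
    fun _ hr => ⟨hr.1, lt_of_le_of_lt (EReal.coe_le_coe_iff.2 hr.2) hs.2⟩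

end IsSolution

/-! ### Barrier argument -/

lemma Ioo_subset_interior_timeInterval {T : EReal} {s : ℝ} (hs : s ∈ timeInterval T) :
    Set.Ioo 0 s ⊆ interior (timeInterval T) :=
  interior_maximal (fun _ hr =>
    ⟨hr.1.le, lt_of_le_of_lt (EReal.coe_le_coe_iff.2 hr.2.le) hs.2⟩) isOpen_Ioo

/-- If `f` does not increase while it is between `A` and `A'` and starts below `A`, then it stays
below `A`. -/
lemma le_of_deriv_nonpos_of_mem_Ioo {f f' : ℝ → ℝ} {s A A' : ℝ} (hs : 0 ≤ s)
    (hf : ContinuousOn f (Set.Icc 0 s)) (hf' : ∀ t ∈ Set.Ioo 0 s, HasDerivAt f (f' t) t)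
    (h0 : f 0 ≤ A) (hA : A < A') (hd : ∀ t ∈ Set.Ioo 0 s, A < f t → f t < A' → f' t ≤ 0) :
    f s ≤ A := by
  by_contra! hlt
  -- A level strictly between A and A' that f reaches by time s. Let p be the first time it is
  -- reached and q the last time before p with f ≤ A: on [q, p] the hypothesis makes f
  -- nonincreasing, so B ≤ f p ≤ f q ≤ A.
  set B := min (f s) ((A + A') / 2) with hB
  have hAB : A < B := lt_min hlt (by linarith)
  have hBA' : B < A' := (min_le_right _ _).trans_lt (by linarith)
  set S := {t ∈ Set.Icc 0 s | B ≤ f t} with hS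
  have hSne : S.Nonempty := ⟨s, ⟨hs, le_rfl⟩, min_le_left _ _⟩
  have hScl : IsClosed S := hf.preimage_isClosed_of_isClosed isClosed_Icc isClosed_Ici
  have hSbdd : BddBelow S := ⟨0, fun t ht => ht.1.1⟩
  set p := sInf S with hp
  have hpS : p ∈ S := hScl.csInf_mem hSne hSbdd
  have hbelow : ∀ t ∈ Set.Icc 0 s, t < p → f t < B := fun t ht htp => by
    by_contra! hle
    exact absurd (csInf_le hSbdd ⟨ht, hle⟩) (not_le.2 htp)
  set R := {t ∈ Set.Icc 0 p | f t ≤ A} with hR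
  have hfp : ContinuousOn f (Set.Icc 0 p) := hf.mono (Set.Icc_subset_Icc_right hpS.1.2)
  have hRne : R.Nonempty := ⟨0, ⟨le_rfl, hpS.1.1⟩, h0⟩
  have hRcl : IsClosed R := hfp.preimage_isClosed_of_isClosed isClosed_Icc isClosed_Iic
  have hRbdd : BddAbove R := ⟨p, fun t ht => ht.1.2⟩
  set q := sSup R with hq
  have hqR : q ∈ R := hRcl.csSup_mem hRne hRbdd
  have habove : ∀ t ∈ Set.Icc 0 p, q < t → A < f t := fun t ht hqt => by
    by_contra! hle
    exact absurd (le_csSup hRbdd ⟨ht, hle⟩) (not_le.2 hqt)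
  have hanti : AntitoneOn f (Set.Icc q p) := by
    have hmem : ∀ t ∈ interior (Set.Icc q p), t ∈ Set.Ioo 0 s ∧ A < f t ∧ f t < A' := fun t ht => by
      rw [interior_Icc] at ht
      have ht0 : 0 < t := hqR.1.1.trans_lt ht.1
      have hts : t < s := ht.2.trans_le hpS.1.2
      exact ⟨⟨ht0, hts⟩, habove t ⟨ht0.le, ht.2.le⟩ ht.1,
        (hbelow t ⟨ht0.le, hts.le⟩ ht.2).trans hBA'⟩
    refine antitoneOn_of_deriv_nonpos (convex_Icc _ _)
      (hfp.mono (Set.Icc_subset_Icc_left hqR.1.1)) (fun t ht => ?_) fun t ht => ?_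
    · exact (hf' t (hmem t ht).1).differentiableAt.differentiableWithinAt
    · rw [(hf' t (hmem t ht).1).deriv]
      exact hd t (hmem t ht).1 (hmem t ht).2.1 (hmem t ht).2.2
  have := hanti ⟨le_rfl, hqR.1.2⟩ ⟨hqR.1.2, le_rfl⟩ hqR.1.2
  linarith [hqR.2, hpS.2]

end CurveFlow

end

noncomputable section

namespace CurveFlow

open JetPoly

/-! ### Integral identities for jets -/

lemma JetPoly.iterate_D_X (i r : ℕ) : (⇑D)^[r] (MvPolynomial.X i) = MvPolynomial.X (i + r) := by
  induction r with
  | zero => rfl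
  | succ r ih => rw [Function.iterate_succ_apply', ih, D_X, add_assoc]

namespace NeumannJet

variable {v : ℝ → ℝ} {u : ℕ → ℝ → ℝ} (hu : NeumannJet v u)

/-- The integral of a differential polynomial over a Neumann jet. -/
def jetIntegral (hu : NeumannJet v u) : JetPoly →ₗ[ℝ] ℝ where
  toFun p := weightedIntegral v (jetEval u p)
  map_add' p q := by
    rw [show jetEval u (p + q) = fun x => jetEval u p x + jetEval u q x from
      funext jetEval_add]
    exact weightedIntegral_add hu.speed (hu.continuousOn_jetEval p) (hu.continuousOn_jetEval q)
  map_smul' r p := by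
    rw [show jetEval u (r • p) = fun x => r * jetEval u p x from funext (jetEval_smul r)]
    exact weightedIntegral_const_mul r

lemma jetIntegral_apply (p : JetPoly) :
    hu.jetIntegral p = weightedIntegral v (jetEval u p) := rfl

lemma jetIntegral_X_mul_X (i : ℕ) :
    hu.jetIntegral (MvPolynomial.X i * MvPolynomial.X i) = weightedNorm v (u i) ^ 2 := by
  rw [weightedNorm_sq hu.speed, jetIntegral_apply]
  congr 1
  ext x
  rw [jetEval_mul, jetEval_X, sq]

lemma jetIntegral_D_eq_zero {p : JetPoly} (h0 : ∀ x ∈ ({-1, 1} : Set ℝ), jetEval u p x = 0) :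
    hu.jetIntegral (D p) = 0 :=
  (hasArcDeriv_jetEval hu.deriv p).integral_eq_zero hu.speed (hu.continuousOn_jetEval _) h0

lemma jetIntegral_mul_D {p q : JetPoly}
    (h0 : ∀ x ∈ ({-1, 1} : Set ℝ), jetEval u p x = 0 ∨ jetEval u q x = 0) :
    hu.jetIntegral (p * D q) = - hu.jetIntegral (D p * q) := by
  have h := hu.jetIntegral_D_eq_zero (p := p * q) fun x hx => by
    rw [jetEval_mul]; exact mul_eq_zero.2 (h0 x hx)
  rw [D_mul, map_add, mul_comm q] at h
  linarith

lemma jetIntegral_X_mul_X_add (i r : ℕ) :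
    hu.jetIntegral (MvPolynomial.X (i + r + r) * MvPolynomial.X i) =
      (-1) ^ r * weightedNorm v (u (i + r)) ^ 2 := by
  rw [← hu.jetIntegral_X_mul_X, jetIntegral_apply,
    hu.integral_X_mul_eq (i + r) r (X_mem i) (by grind), iterate_D_X, jetIntegral_apply]

include hu

lemma jetEval_timePoly_eq_zero (m : ℕ) {ℓ : ℕ} (hℓ : Odd ℓ) {x : ℝ}
    (hx : x ∈ ({-1, 1} : Set ℝ)) : jetEval u (timePoly m ℓ) x = 0 := by
  obtain ⟨A, hA, B, hB, h⟩ := timePoly_eq m ℓ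
  rw [h, jetEval_add, jetEval_add, jetEval_smul, hu.jetEval_eq_zero (by grind) hA hx,
    hu.jetEval_eq_zero (by grind) hB hx, hu.jetEval_eq_zero (by grind) (X_mem _) hx]
  ring

lemma jetEval_D_speedPoly_eq_zero (m : ℕ) {x : ℝ} (hx : x ∈ ({-1, 1} : Set ℝ)) :
    jetEval u (D (speedPoly m)) x = 0 := by
  obtain ⟨A, hA, h⟩ := D_speedPoly_eq m
  rw [h, jetEval_add, jetEval_smul, hu.jetEval_eq_zero (by simp) hA hx,
    hu.jetEval_eq_zero (by grind) (X_mem _) hx]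
  ring

/-- By its recursion `timePoly m (p + 1)` is a total derivative plus the commutator term k F
u_{p+1}. Each integration by parts moves that derivative to the other factor and releases one
commutator term. At the ends either the curvature factor or `timePoly m p` vanishes, according to
the parity of p. -/
lemma jetIntegral_X_mul_timePoly_eq_sum_add (m ℓ : ℕ) {j : ℕ} (hj : j ≤ ℓ) :
    hu.jetIntegral (MvPolynomial.X ℓ * timePoly m ℓ) =
      ∑ i ∈ Finset.range j, (-1) ^ i * hu.jetIntegral (speedPoly m *
        (MvPolynomial.X 0 * (MvPolynomial.X (ℓ + i) * MvPolynomial.X (ℓ - i)))) +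
      (-1) ^ j * hu.jetIntegral (MvPolynomial.X (ℓ + j) * timePoly m (ℓ - j)) := by
  induction j with
  | zero => simp
  | succ j ih =>
    obtain ⟨p, rfl⟩ : ∃ p, ℓ = p + j + 1 := ⟨ℓ - j - 1, by omega⟩
    rw [ih (by omega), Finset.sum_range_succ, show p + j + 1 - j = p + 1 by omega,
      show p + j + 1 - (j + 1) = p by omega]
    have h1 := hu.jetIntegral_mul_D (p := MvPolynomial.X (p + j + 1 + j)) (q := timePoly m p)
      fun x hx => by
        rcases Nat.even_or_odd p with hp | hp
        · rw [jetEval_X]; exact Or.inl (hu.eq_zero_of_odd (by grind) hx)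
        · exact Or.inr (hu.jetEval_timePoly_eq_zero m hp hx)
    rw [D_X] at h1
    rw [timePoly, mul_add, map_add, h1, ← add_assoc (p + j + 1)]
    have h2 : (MvPolynomial.X (p + j + 1 + j) *
        (MvPolynomial.X 0 * speedPoly m * MvPolynomial.X (p + 1)) : JetPoly) =
        speedPoly m * (MvPolynomial.X 0 *
          (MvPolynomial.X (p + j + 1 + j) * MvPolynomial.X (p + 1))) := by ring
    rw [h2]
    ring

/-- After ℓ steps k_t = F_ss + k² F remains. Two more integrations by parts free F from derivatives,
and the term k² F supplies the summand i = ℓ. -/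
lemma jetIntegral_X_mul_timePoly (m ℓ : ℕ) :
    hu.jetIntegral (MvPolynomial.X ℓ * timePoly m ℓ) =
      ∑ i ∈ Finset.range (ℓ + 1), (-1) ^ i * hu.jetIntegral (speedPoly m *
        (MvPolynomial.X 0 * (MvPolynomial.X (ℓ + i) * MvPolynomial.X (ℓ - i)))) +
      (-1) ^ ℓ * hu.jetIntegral (speedPoly m * MvPolynomial.X (2 * ℓ + 2)) := by
  have h1 := hu.jetIntegral_mul_D (p := MvPolynomial.X (ℓ + ℓ)) (q := D (speedPoly m))
    fun x hx => Or.inr (hu.jetEval_D_speedPoly_eq_zero m hx)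
  have h2 := hu.jetIntegral_mul_D (p := MvPolynomial.X (ℓ + ℓ + 1)) (q := speedPoly m)
    fun x hx => by rw [jetEval_X]; exact Or.inl (hu.eq_zero_of_odd (by grind) hx)
  rw [D_X] at h1 h2
  rw [hu.jetIntegral_X_mul_timePoly_eq_sum_add m ℓ le_rfl, Finset.sum_range_succ, Nat.sub_self,
    timePoly, mul_add, map_add, h1, h2]
  have h3 : (MvPolynomial.X (ℓ + ℓ) * (MvPolynomial.X 0 * MvPolynomial.X 0 * speedPoly m)
      : JetPoly) = speedPoly m *
        (MvPolynomial.X 0 * (MvPolynomial.X (ℓ + ℓ) * MvPolynomial.X 0)) := by ring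
  rw [h3, show ℓ + ℓ + 1 + 1 = 2 * ℓ + 2 by ring, mul_comm (MvPolynomial.X (2 * ℓ + 2))]
  ring

/-- The first variation of `∫ k_{s^ℓ}²` in the direction of the speed of order `m`. -/
lemma jetIntegral_firstVariation (m ℓ : ℕ) :
    hu.jetIntegral ((2 : ℝ) • (MvPolynomial.X ℓ * timePoly m ℓ) -
      MvPolynomial.X 0 * speedPoly m * (MvPolynomial.X ℓ * MvPolynomial.X ℓ)) =
      -2 * hu.jetIntegral (speedPoly m * speedPoly ℓ) := by
  have h1 : (MvPolynomial.X 0 * speedPoly m * (MvPolynomial.X ℓ * MvPolynomial.X ℓ) : JetPoly) =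
      speedPoly m * (MvPolynomial.X 0 * (MvPolynomial.X ℓ * MvPolynomial.X ℓ)) := by ring
  -- The summand i = 0 occurs twice and loses one copy to the change of ds. This produces the
  -- coefficient 1/2 in `speedPoly ℓ`.
  have h2 : ∑ i ∈ Finset.range (ℓ + 1), (-1) ^ i * hu.jetIntegral (speedPoly m *
        (MvPolynomial.X 0 * (MvPolynomial.X (ℓ + i) * MvPolynomial.X (ℓ - i)))) =
      hu.jetIntegral (speedPoly m * (MvPolynomial.X 0 * (MvPolynomial.X ℓ * MvPolynomial.X ℓ))) +
      ∑ i ∈ Finset.Icc 1 ℓ, (-1) ^ i * hu.jetIntegral (speedPoly m *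
        (MvPolynomial.X 0 * (MvPolynomial.X (ℓ + i) * MvPolynomial.X (ℓ - i)))) := by
    rw [Finset.range_eq_Ico, Finset.sum_eq_sum_Ico_succ_bot (by omega)]
    simp only [pow_zero, one_mul, add_zero, Nat.sub_zero, zero_add]
    rfl
  rw [map_sub, map_smul, hu.jetIntegral_X_mul_timePoly, h1, h2, speedPoly.eq_def ℓ, cubicPart,
    mul_add, mul_sub, mul_neg, Finset.mul_sum]
  simp only [mul_smul_comm, map_add, map_sub, map_neg, map_sum, map_smul, smul_eq_mul]
  ring

end NeumannJet

/-! ### Estimates for jets -/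

/-- The length is nonincreasing if the scale-invariant energy is small. -/
lemma exists_length_estimate (m : ℕ) :
    ∃ C : ℝ, 0 ≤ C ∧ ∀ (v : ℝ → ℝ) (u : ℕ → ℝ → ℝ) (hu : NeumannJet v u),
      - hu.jetIntegral (MvPolynomial.X 0 * speedPoly m) ≤
        (C * (weightedIntegral v (fun _ => 1) ^ (2 * m + 1) * weightedNorm v (u m) ^ 2) - 1) *
          weightedNorm v (u (m + 1)) ^ 2 := by
  have hmem : MvPolynomial.X 0 * cubicPart m ∈ homog (2 + 2) (2 * m) := by
    have := homog_mul_mem (X_mem 0) (cubicPart_mem m)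
    rwa [zero_add, show 1 + 3 = 2 + 2 by norm_num] at this
  obtain ⟨C, hC, hb⟩ := JetBound.of_mem (N := m + 1) (by simp) (by omega) hmem
  refine ⟨C, hC, fun v u hu => ?_⟩
  obtain ⟨μ, hμ, hY, hi, hL⟩ := hu.exists_interpolation (N := m + 1) (by omega)
  have h1 := neg_le_of_abs_le (hb v u μ hu hμ hi)
  rw [← hu.jetIntegral_apply] at h1
  have hmain := hu.jetIntegral_X_mul_X_add 0 (m + 1)
  rw [zero_add, mul_comm, show m + 1 + (m + 1) = 2 * m + 2 by ring] at hmain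
  have hsign : ((-1 : ℝ) ^ (m + 1)) * (-1) ^ (m + 1) = 1 := by
    rw [← mul_pow]; norm_num
  rw [speedPoly, mul_add, map_add, mul_smul_comm, map_smul, smul_eq_mul, hmain, ← mul_assoc,
    hsign, one_mul]
  set X := weightedNorm v (u 0)
  set Y := weightedNorm v (u (m + 1))
  set Z := weightedNorm v (u m)
  set Λ := weightedIntegral v (fun _ => 1)
  have hΛ : 0 < Λ := weightedIntegral_one_pos hu.speed
  have hX : 0 ≤ X := weightedNorm_nonneg
  have hXZ : X ≤ Λ ^ m * Z := by simpa using hu.norm_le_add 0 m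
  -- Two factors X are traded for the energy by Poincaré. The missing μ² comes from 1 ≤ Λ μ² and
  -- completes Y².
  have h2 : X ^ (2 + 2) * μ ^ (2 * (2 * m) + 2) ≤ Λ ^ (2 * m + 1) * Z ^ 2 * Y ^ 2 :=
    calc X ^ (2 + 2) * μ ^ (2 * (2 * m) + 2)
        = X ^ 2 * ((X * μ ^ (2 * m + 1)) ^ 2 * 1) := by ring
      _ ≤ (Λ ^ m * Z) ^ 2 * ((X * μ ^ (2 * m + 1)) ^ 2 * (Λ * μ ^ 2)) := by gcongr
      _ = _ := by rw [hY]; ring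
  have h3 := mul_le_mul_of_nonneg_left h2 hC
  linarith

lemma speedPoly_mul_speedPoly (m ℓ : ℕ) :
    ∃ A ∈ homog (2 + 2) (2 * (m + ℓ + 1)), ∃ B ∈ homog (4 + 2) (2 * (m + ℓ)),
      speedPoly m * speedPoly ℓ = ((-1 : ℝ) ^ (m + 1) * (-1) ^ (ℓ + 1)) •
        (MvPolynomial.X (2 * ℓ + 2) * MvPolynomial.X (2 * m + 2)) + A + B := by
  have h1 := homog_mul_mem (X_mem (2 * m + 2)) (cubicPart_mem ℓ)
  have h2 := homog_mul_mem (X_mem (2 * ℓ + 2)) (cubicPart_mem m)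
  have h3 := homog_mul_mem (cubicPart_mem m) (cubicPart_mem ℓ)
  rw [show 1 + 3 = 2 + 2 by norm_num, show 2 * m + 2 + 2 * ℓ = 2 * (m + ℓ + 1) by ring] at h1
  rw [show 1 + 3 = 2 + 2 by norm_num, show 2 * ℓ + 2 + 2 * m = 2 * (m + ℓ + 1) by ring] at h2
  rw [show 3 + 3 = 4 + 2 by norm_num, show 2 * m + 2 * ℓ = 2 * (m + ℓ) by ring] at h3
  refine ⟨_, add_mem (Submodule.smul_mem _ ((-1) ^ (m + 1)) h1)
    (Submodule.smul_mem _ ((-1) ^ (ℓ + 1)) h2), _, h3, ?_⟩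
  rw [speedPoly, speedPoly, add_mul, mul_add, mul_add, smul_mul_smul_comm, smul_mul_assoc,
    mul_smul_comm, mul_comm (cubicPart m) (MvPolynomial.X (2 * ℓ + 2)),
    mul_comm (MvPolynomial.X (2 * ℓ + 2)) (MvPolynomial.X (2 * m + 2))]
  abel

/-- Where `∫ k_{s^ℓ}²` exceeds a bound in terms of the length and `∫ k²`, it is nonincreasing. -/
lemma exists_energy_estimate {m ℓ : ℕ} (hmℓ : m < ℓ) :
    ∃ C : ℝ, 0 ≤ C ∧ ∀ (v : ℝ → ℝ) (u : ℕ → ℝ → ℝ) (hu : NeumannJet v u),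
      0 ≤ hu.jetIntegral (speedPoly m * speedPoly ℓ) ∨
      weightedNorm v (u ℓ) ^ 2 ≤ weightedIntegral v (fun _ => 1) ^ (2 * (m + 2)) *
        (weightedNorm v (u 0) ^ 2 * (C * weightedNorm v (u 0) ^ 2) ^ (2 * (ℓ + m + 2))) := by
  obtain ⟨A, hA, B, hB, hAB⟩ := speedPoly_mul_speedPoly m ℓ
  obtain ⟨C₁, hC₁, hb₁⟩ := JetBound.of_mem (N := ℓ + m + 2) (by simp) (by omega) hA
  obtain ⟨C₂, hC₂, hb₂⟩ := JetBound.of_mem (N := ℓ + m + 2) (by simp) (by omega) hB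
  -- The summand 1 gives X² ≤ μ² in the first case below, so the sextic term is absorbed like the
  -- quartic one.
  refine ⟨1 + C₁ + C₂, by positivity, fun v u hu => ?_⟩
  obtain ⟨μ, hμ, hY, hi, -⟩ := hu.exists_interpolation (N := ℓ + m + 2) (by omega)
  have h1 := neg_le_of_abs_le (hb₁ v u μ hu hμ hi)
  have h2 := neg_le_of_abs_le (hb₂ v u μ hu hμ hi)
  rw [← hu.jetIntegral_apply] at h1 h2
  have hmain : ((-1 : ℝ) ^ (m + 1) * (-1) ^ (ℓ + 1)) *
      hu.jetIntegral (MvPolynomial.X (2 * ℓ + 2) * MvPolynomial.X (2 * m + 2)) =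
      weightedNorm v (u (ℓ + m + 2)) ^ 2 := by
    obtain ⟨r, rfl⟩ := Nat.exists_eq_add_of_le hmℓ.le
    have := hu.jetIntegral_X_mul_X_add (2 * m + 2) r
    rw [show 2 * (m + r) + 2 = 2 * m + 2 + r + r by ring, this,
      show m + r + m + 2 = 2 * m + 2 + r by ring, ← mul_assoc, ← pow_add, ← pow_add,
      Even.neg_one_pow ⟨m + 1 + r, by ring⟩, one_mul]
  have hPos := hu.norm_le_add ℓ (m + 2)
  rw [← add_assoc ℓ] at hPos
  rw [hAB, map_add, map_add, map_smul, smul_eq_mul, hmain]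
  set X := weightedNorm v (u 0)
  set Y := weightedNorm v (u (ℓ + m + 2))
  set Λ := weightedIntegral v (fun _ => 1)
  have hX : 0 ≤ X := weightedNorm_nonneg
  have hΛ : 0 < Λ := weightedIntegral_one_pos hu.speed
  rcases le_or_gt ((1 + C₁ + C₂) * X ^ 2) (μ ^ 2) with hle | hlt
  · left
    have h3 : C₁ * X ^ 2 * μ ^ 2 + C₂ * X ^ 4 ≤ μ ^ 4 := by
      have hXμ : X ^ 2 ≤ μ ^ 2 := by nlinarith [sq_nonneg X]
      calc C₁ * X ^ 2 * μ ^ 2 + C₂ * X ^ 4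
          = C₁ * X ^ 2 * μ ^ 2 + C₂ * X ^ 2 * X ^ 2 := by ring
        _ ≤ C₁ * X ^ 2 * μ ^ 2 + C₂ * X ^ 2 * μ ^ 2 := by gcongr
        _ ≤ (1 + C₁ + C₂) * X ^ 2 * μ ^ 2 := by nlinarith [sq_nonneg (X * μ)]
        _ ≤ μ ^ 2 * μ ^ 2 := by gcongr
        _ = μ ^ 4 := by ring
    have h4 := mul_le_mul_of_nonneg_left h3
      (show 0 ≤ X ^ 2 * μ ^ (4 * (ℓ + m + 1)) by positivity)
    have e1 : Y ^ 2 = X ^ 2 * μ ^ (4 * (ℓ + m + 1)) * μ ^ 4 := by rw [hY]; ring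
    have e2 : C₁ * X ^ (2 + 2) * μ ^ (2 * (2 * (m + ℓ + 1)) + 2) +
        C₂ * X ^ (4 + 2) * μ ^ (2 * (2 * (m + ℓ)) + 4) =
        X ^ 2 * μ ^ (4 * (ℓ + m + 1)) * (C₁ * X ^ 2 * μ ^ 2 + C₂ * X ^ 4) := by ring
    linarith
  -- Here μ² is below a multiple of X², so the top norm, and by Poincaré the norm of order ℓ, is
  -- bounded by Λ and X alone.
  · right
    calc weightedNorm v (u ℓ) ^ 2 ≤ (Λ ^ (m + 2) * Y) ^ 2 :=
          pow_le_pow_left₀ weightedNorm_nonneg hPos 2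
      _ = Λ ^ (2 * (m + 2)) * (X ^ 2 * (μ ^ 2) ^ (2 * (ℓ + m + 2))) := by rw [hY]; ring
      _ ≤ _ := by gcongr

/-! ### Evolution of length and energies -/

namespace IsSolution

variable {m : ℕ} {e : Plane} {a b : ℝ} {T : EReal} {γ : ℝ → ℝ → Plane}
  (h : IsSolution m e a b T γ) (hT : 0 < T) (he : ‖e‖ = 1)
include h hT he

/-- The winding number stays zero. -/
lemma integral_curvature_eq_zero (h0 : windingNumber (γ 0) = 0) {t : ℝ}
    (ht : t ∈ timeInterval T) :
    weightedIntegral (speed (γ t)) (curvatureDeriv (γ t) 0) = 0 := by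
  set f : ℝ → ℝ := fun r => weightedIntegral (speed (γ r)) (curvatureDeriv (γ r) 0) with hf
  have hf0 : f 0 = 0 := (mul_eq_zero.1 h0).resolve_left (by positivity)
  have hc : ContinuousOn f (Set.Icc 0 t) :=
    h.continuousOn_weightedIntegral hT (h.smoothFamily_curvatureDeriv hT 0) ht
  have hd : ∀ r ∈ Set.Ioo 0 t, HasDerivAt f 0 r := fun r hr => by
    have hr' := Ioo_subset_interior_timeInterval ht hr
    have hrI := interior_subset hr'
    refine (h.hasDerivAt_weightedIntegral hT (h.smoothFamily_curvatureDeriv hT 0) hr' fun x hx =>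
      h.hasDerivWithinAt_curvatureDeriv hT hrI hx 0).congr_deriv ?_
    have harc := h.hasArcDeriv_curvatureDeriv hT hrI
    -- The term k² F cancels against the change of ds. What remains is ∫ F_ss, which vanishes
    -- because F_s is zero at the ends.
    rw [← (hasArcDeriv_jetEval harc (D (speedPoly m))).integral_eq_zero (h.isSpeed hT hrI)
      (hasArcDeriv_jetEval harc _).continuousOn
      fun x hx => h.jetEval_D_speedPoly_eq_zero hT he hrI hx]
    refine weightedIntegral_congr fun x _ => ?_
    rw [timePoly, jetEval_add, jetEval_mul, jetEval_mul, jetEval_X, normalSpeed_eq]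
    change _ + curvature (γ r) x * curvature (γ r) x * _ - _ * _ * curvature (γ r) x = _
    ring
  refine le_antisymm ?_ ?_
  · exact le_of_deriv_nonpos_of_mem_Ioo (f := f) ht.1 hc hd hf0.le one_pos fun _ _ _ _ => le_rfl
  · have := le_of_deriv_nonpos_of_mem_Ioo (f := fun r => - f r) (f' := fun _ => -0) ht.1 hc.neg
      (fun r hr => (hd r hr).neg) (by simp [hf0]) one_pos fun _ _ _ _ => by simp
    linarith

variable (h0 : windingNumber (γ 0) = 0)
include h0

/-- The curvature and its derivatives form a Neumann jet. -/
lemma neumannJet {t : ℝ} (ht : t ∈ timeInterval T) :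
    NeumannJet (speed (γ t)) (curvatureDeriv (γ t)) where
  speed := h.isSpeed hT ht
  deriv := h.hasArcDeriv_curvatureDeriv hT ht
  odd i _ hx := h.curvatureDeriv_odd_eq_zero hT he i ht hx
  mean := h.integral_curvature_eq_zero hT he h0 ht

omit he h0 in
lemma energy_eq {t : ℝ} (ht : t ∈ timeInterval T) (ℓ : ℕ) :
    energy ℓ (γ t) = weightedNorm (speed (γ t)) (curvatureDeriv (γ t) ℓ) ^ 2 :=
  (weightedNorm_sq (h.isSpeed hT ht)).symm

lemma hasDerivAt_length {t : ℝ} (ht : t ∈ interior (timeInterval T)) :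
    HasDerivAt (fun r => length (γ r))
      (-(h.neumannJet hT he h0 (interior_subset ht)).jetIntegral
        (MvPolynomial.X 0 * speedPoly m)) t := by
  have := h.hasDerivAt_weightedIntegral hT (SmoothFamily.const 1) ht (f' := fun _ => 0)
    fun x _ => hasDerivWithinAt_const t _ 1
  refine this.congr_deriv ?_
  rw [NeumannJet.jetIntegral_apply, ← weightedIntegral_neg]
  refine weightedIntegral_congr fun x _ => ?_
  rw [jetEval_mul, jetEval_X, normalSpeed_eq, zero_sub, mul_one]
  rfl

lemma hasDerivAt_energy (ℓ : ℕ) {t : ℝ} (ht : t ∈ interior (timeInterval T)) :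
    HasDerivAt (fun r => energy ℓ (γ r))
      (-2 * (h.neumannJet hT he h0 (interior_subset ht)).jetIntegral
        (speedPoly m * speedPoly ℓ)) t := by
  have ht' := interior_subset ht
  rw [← NeumannJet.jetIntegral_firstVariation]
  have := h.hasDerivAt_weightedIntegral hT ((h.smoothFamily_curvatureDeriv hT ℓ).pow 2) ht
    fun x hx => (h.hasDerivWithinAt_curvatureDeriv hT ht' hx ℓ).pow 2
  refine this.congr_deriv (weightedIntegral_congr fun x _ => ?_)
  rw [sub_eq_add_neg _ (MvPolynomial.X 0 * speedPoly m * _),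
    ← neg_one_smul ℝ (MvPolynomial.X 0 * speedPoly m * _), jetEval_add, jetEval_smul,
    jetEval_smul, jetEval_mul, jetEval_mul, jetEval_mul, jetEval_mul, jetEval_X, jetEval_X,
    normalSpeed_eq]
  change _ - curvature (γ t) x * _ * _ = _ + -1 * (curvature (γ t) x * _ * _)
  norm_num
  ring

omit he h0 in
lemma continuousOn_length {t : ℝ} (ht : t ∈ timeInterval T) :
    ContinuousOn (fun r => length (γ r)) (Set.Icc 0 t) :=
  h.continuousOn_weightedIntegral hT (SmoothFamily.const 1) ht

omit he h0 in
lemma continuousOn_energy (ℓ : ℕ) {t : ℝ} (ht : t ∈ timeInterval T) :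
    ContinuousOn (fun r => energy ℓ (γ r)) (Set.Icc 0 t) :=
  h.continuousOn_weightedIntegral hT ((h.smoothFamily_curvatureDeriv hT ℓ).pow 2) ht

/-- Gradient flow: the derivative is -2 ∫ F². -/
lemma energy_le_initial {t : ℝ} (ht : t ∈ timeInterval T) : energy m (γ t) ≤ energy m (γ 0) := by
  refine le_of_deriv_nonpos_of_mem_Ioo (f := fun r => energy m (γ r)) ht.1
    (h.continuousOn_energy hT m ht)
    (f' := fun r => deriv (fun r => energy m (γ r)) r) (fun r hr => ?_) le_rfl (lt_add_one _)
    fun r hr _ _ => ?_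
  · exact (h.hasDerivAt_energy hT he h0 m
      (Ioo_subset_interior_timeInterval ht hr)).differentiableAt.hasDerivAt
  · have hr' := Ioo_subset_interior_timeInterval ht hr
    rw [(h.hasDerivAt_energy hT he h0 m hr').deriv]
    have : 0 ≤ (h.neumannJet hT he h0 (interior_subset hr')).jetIntegral
        (speedPoly m * speedPoly m) :=
      weightedIntegral_nonneg (h.isSpeed hT (interior_subset hr')) fun x _ => by
        rw [jetEval_mul]; exact mul_self_nonneg _
    linarith

end IsSolution

/-- The quantity which the energy of order `ℓ` cannot exceed while increasing. -/
def energyBound (m : ℕ) (c : ℕ → ℝ) (ℓ : ℕ) (L E : ℝ) : ℝ :=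
  if ℓ ≤ m then L ^ (2 * (m - ℓ)) * E
  else L ^ (2 * (m + 2)) * ((L ^ (2 * m) * E) * (c ℓ * (L ^ (2 * m) * E)) ^ (2 * (ℓ + m + 2)))

/-! ### Bounds for length and energies along the flow -/

namespace IsSolution

variable {m : ℕ} {e : Plane} {a b : ℝ} {T : EReal} {γ : ℝ → ℝ → Plane}
  (h : IsSolution m e a b T γ) (hT : 0 < T) (he : ‖e‖ = 1) (h0 : windingNumber (γ 0) = 0)
include h hT

lemma length_pos {t : ℝ} (ht : t ∈ timeInterval T) : 0 < length (γ t) :=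
  weightedIntegral_one_pos (h.isSpeed hT ht)

omit hT in
lemma energy_nonneg (ℓ : ℕ) {t : ℝ} (ht : t ∈ timeInterval T) : 0 ≤ energy ℓ (γ t) :=
  intervalIntegral.integral_nonneg (by norm_num) fun _ hx =>
    mul_nonneg (sq_nonneg _) (h.speed_pos ht hx).le

include he h0

/-- If the initial energy is small, then the length stays below its initial value. -/
lemma length_le_initial {C : ℝ} (hC : 0 ≤ C)
    (hest : ∀ (v : ℝ → ℝ) (u : ℕ → ℝ → ℝ) (hu : NeumannJet v u),
      - hu.jetIntegral (MvPolynomial.X 0 * speedPoly m) ≤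
        (C * (weightedIntegral v (fun _ => 1) ^ (2 * m + 1) * weightedNorm v (u m) ^ 2) - 1) *
          weightedNorm v (u (m + 1)) ^ 2)
    (hsmall : C * ((2 * length (γ 0)) ^ (2 * m + 1) * energy m (γ 0)) ≤ 1)
    {t : ℝ} (ht : t ∈ timeInterval T) : length (γ t) ≤ length (γ 0) := by
  have hzero : (0 : ℝ) ∈ timeInterval T := ⟨le_rfl, hT⟩
  have hL0 := h.length_pos hT hzero
  -- While the length is below 2 L_0, the scale-invariant energy is at most 2^(2m+1) times its
  -- initial value. The smallness hypothesis is adapted to this, so the length cannot grow in that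
  -- window.
  refine le_of_deriv_nonpos_of_mem_Ioo (f := fun r => length (γ r))
    (f' := fun r => deriv (fun r => length (γ r)) r) (A' := 2 * length (γ 0)) ht.1
    (h.continuousOn_length hT ht) (fun r hr => ?_) le_rfl (by linarith) fun r hr _ hlt => ?_
  · exact (h.hasDerivAt_length hT he h0
      (Ioo_subset_interior_timeInterval ht hr)).differentiableAt.hasDerivAt
  · have hr' := Ioo_subset_interior_timeInterval ht hr
    have hrI := interior_subset hr'
    rw [(h.hasDerivAt_length hT he h0 hr').deriv]
    refine (hest _ _ (h.neumannJet hT he h0 hrI)).trans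
      (mul_nonpos_of_nonpos_of_nonneg ?_ (sq_nonneg _))
    rw [← h.energy_eq hT hrI]
    have h1 : length (γ r) ^ (2 * m + 1) * energy m (γ r) ≤
        (2 * length (γ 0)) ^ (2 * m + 1) * energy m (γ 0) :=
      mul_le_mul (pow_le_pow_left₀ (h.length_pos hT hrI).le hlt.le _)
        (h.energy_le_initial hT he h0 hrI) (h.energy_nonneg m hrI) (by positivity)
    have h2 := mul_le_mul_of_nonneg_left h1 hC
    change C * (length (γ r) ^ (2 * m + 1) * energy m (γ r)) - 1 ≤ 0
    linarith

/-- The energies of order `ℓ ≤ m` are controlled by the Poincaré inequality. -/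
lemma energy_le_of_le {t : ℝ} (ht : t ∈ timeInterval T) (hL : length (γ t) ≤ length (γ 0))
    {ℓ : ℕ} (hℓ : ℓ ≤ m) :
    energy ℓ (γ t) ≤ length (γ 0) ^ (2 * (m - ℓ)) * energy m (γ 0) := by
  have hP := (h.neumannJet hT he h0 ht).norm_le_add ℓ (m - ℓ)
  rw [Nat.add_sub_cancel' hℓ] at hP
  have hpos := h.length_pos hT ht
  calc energy ℓ (γ t) = weightedNorm (speed (γ t)) (curvatureDeriv (γ t) ℓ) ^ 2 :=
        h.energy_eq hT ht ℓ
    _ ≤ (length (γ t) ^ (m - ℓ) *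
          weightedNorm (speed (γ t)) (curvatureDeriv (γ t) m)) ^ 2 :=
        pow_le_pow_left₀ weightedNorm_nonneg hP 2
    _ = length (γ t) ^ (2 * (m - ℓ)) * energy m (γ t) := by rw [h.energy_eq hT ht]; ring
    _ ≤ _ := mul_le_mul (pow_le_pow_left₀ hpos.le hL _) (h.energy_le_initial hT he h0 ht)
        (h.energy_nonneg m ht) (pow_nonneg (hpos.le.trans hL) _)

/-- Above the barrier the second alternative of `hest` is impossible, because L ≤ L_0 and ∫ k² ≤
L_0^(2m) E_0 bound its right-hand side by `energyBound`. So the first one holds and the derivative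
is nonpositive. -/
lemma energy_le_max {c : ℕ → ℝ} {ℓ : ℕ} (hℓ : m < ℓ) (hc : 0 ≤ c ℓ)
    (hest : ∀ (v : ℝ → ℝ) (u : ℕ → ℝ → ℝ) (hu : NeumannJet v u),
      0 ≤ hu.jetIntegral (speedPoly m * speedPoly ℓ) ∨
      weightedNorm v (u ℓ) ^ 2 ≤ weightedIntegral v (fun _ => 1) ^ (2 * (m + 2)) *
        (weightedNorm v (u 0) ^ 2 * (c ℓ * weightedNorm v (u 0) ^ 2) ^ (2 * (ℓ + m + 2))))
    (hL : ∀ t ∈ timeInterval T, length (γ t) ≤ length (γ 0)) {t : ℝ} (ht : t ∈ timeInterval T) :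
    energy ℓ (γ t) ≤
      max (energy ℓ (γ 0)) (energyBound m c ℓ (length (γ 0)) (energy m (γ 0))) := by
  refine le_of_deriv_nonpos_of_mem_Ioo (f := fun r => energy ℓ (γ r))
    (f' := fun r => deriv (fun r => energy ℓ (γ r)) r) ht.1
    (h.continuousOn_energy hT ℓ ht) (fun r hr => ?_) (le_max_left _ _) (lt_add_one _)
    fun r hr hlt _ => ?_
  · exact (h.hasDerivAt_energy hT he h0 ℓ
      (Ioo_subset_interior_timeInterval ht hr)).differentiableAt.hasDerivAt
  · have hr' := Ioo_subset_interior_timeInterval ht hr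
    have hrI := interior_subset hr'
    rw [(h.hasDerivAt_energy hT he h0 ℓ hr').deriv]
    rcases hest _ _ (h.neumannJet hT he h0 hrI) with h1 | h1
    · linarith
    · rw [← h.energy_eq hT hrI, ← h.energy_eq hT hrI] at h1
      have hK := h.energy_le_of_le hT he h0 hrI (hL r hrI) (Nat.zero_le m)
      rw [Nat.sub_zero] at hK
      have hE := h.energy_nonneg 0 hrI
      have hpos := h.length_pos hT hrI
      have hpos0 := hpos.le.trans (hL r hrI)
      have h2 : length (γ r) ^ (2 * (m + 2)) *
          (energy 0 (γ r) * (c ℓ * energy 0 (γ r)) ^ (2 * (ℓ + m + 2))) ≤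
          energyBound m c ℓ (length (γ 0)) (energy m (γ 0)) := by
        rw [energyBound, if_neg (by omega)]
        have hK0 := hE.trans hK
        gcongr
        exact hL r hrI
      exact absurd (h1.trans h2) (not_le.2 ((le_max_right _ _).trans_lt hlt))

end IsSolution

end CurveFlow
end

/-! ### Choice of the constants and conclusion -/

theorem proposition4p4 (m : ℕ) :
    ∃ ε : ℝ, 0 < ε ∧ ∃ C : ℕ → ℝ → ℝ → ℝ,
      ∀ (e : CurveFlow.Plane) (a b : ℝ) (T : EReal) (γ : ℝ → ℝ → CurveFlow.Plane),
        ‖e‖ = 1 → a ≠ b → 0 < T →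
        CurveFlow.IsSolution m e a b T γ →
        CurveFlow.windingNumber (γ 0) = 0 →
        CurveFlow.length (γ 0) ^ (2 * m + 1) * CurveFlow.energy m (γ 0) ≤ ε →
        ∀ ℓ : ℕ, ∀ t ∈ CurveFlow.timeInterval T,
          (ℓ ≤ m → CurveFlow.energy ℓ (γ t) ≤
            C ℓ (CurveFlow.length (γ 0)) (CurveFlow.energy m (γ 0))) ∧
          CurveFlow.energy ℓ (γ t) ≤
            max (CurveFlow.energy ℓ (γ 0))
              (C ℓ (CurveFlow.length (γ 0)) (CurveFlow.energy m (γ 0))) := by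
  obtain ⟨C, hC, hlength⟩ := CurveFlow.exists_length_estimate m
  have henergy := fun (ℓ : ℕ) (hℓ : m < ℓ) => CurveFlow.exists_energy_estimate hℓ
  choose! c hc hest using henergy
  -- The power of 2 pays for the window up to 2 L_0 in the length argument, and C + 1 keeps ε well
  -- defined when C = 0.
  refine ⟨(2 ^ (2 * m + 1) * (C + 1))⁻¹, by positivity, CurveFlow.energyBound m c, ?_⟩
  intro e a b T γ he _ hT h h0 hsmall
  have hzero : (0 : ℝ) ∈ CurveFlow.timeInterval T := ⟨le_rfl, hT⟩
  have hE := h.energy_nonneg m hzero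
  have hL0 := h.length_pos hT hzero
  have hsmall' : C * ((2 * CurveFlow.length (γ 0)) ^ (2 * m + 1) * CurveFlow.energy m (γ 0)) ≤
      1 := by
    have h1 : 2 ^ (2 * m + 1) * (C + 1) *
        (CurveFlow.length (γ 0) ^ (2 * m + 1) * CurveFlow.energy m (γ 0)) ≤ 1 := by
      calc _ ≤ 2 ^ (2 * m + 1) * (C + 1) * (2 ^ (2 * m + 1) * (C + 1))⁻¹ := by gcongr
        _ = 1 := mul_inv_cancel₀ (by positivity)
    have h2 : 0 ≤ 2 ^ (2 * m + 1) *
        (CurveFlow.length (γ 0) ^ (2 * m + 1) * CurveFlow.energy m (γ 0)) := by positivity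
    rw [mul_pow]
    nlinarith
  have hL : ∀ t ∈ CurveFlow.timeInterval T, CurveFlow.length (γ t) ≤ CurveFlow.length (γ 0) :=
    fun t ht => h.length_le_initial hT he h0 hC hlength hsmall' ht
  intro ℓ t ht
  rcases le_or_gt ℓ m with hℓ | hℓ
  · have h1 : CurveFlow.energy ℓ (γ t) ≤
        CurveFlow.energyBound m c ℓ (CurveFlow.length (γ 0)) (CurveFlow.energy m (γ 0)) := by
      rw [CurveFlow.energyBound, if_pos hℓ]
      exact h.energy_le_of_le hT he h0 ht (hL t ht) hℓ
    exact ⟨fun _ => h1, h1.trans (le_max_right _ _)⟩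
  · exact ⟨fun hle => absurd hℓ (not_lt.2 hle),
      h.energy_le_max hT he h0 hℓ (hc ℓ hℓ) (hest ℓ hℓ) hL ht⟩
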